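/- **Corollary (Multilinear Recursion).** Let $x=(x_1,\dots,x_n)$ be i.i.d. real random variables with $\mathbb E x_i=0$, $\mathbb E x_i^2=1$ and $|x_i|\le L$ almost surely. For $d\ge 1$ let $\mathcal T^d_n$ be the set of $d$-tuples of pairwise distinct elements of $[n]$, and for $1\le d\le D$ let $(A_{\mathbf i})_{\mathbf i\in\mathcal T^d_n}$ be real matrices, all of the same size $d_1\times d_2$, with $A_{i_1,\dots,i_d}=A_{i_{\sigma(1)},\dots,i_{\sigma(d)}}$ for every permutation $\sigma$ of $\{1,\dots,d\}$. Put $$F(x)=\sum_{d=1}^D F^{=d}(x),\qquad F^{=d}(x)=\sum_{\mathbf i\in\mathcal T^d_n}A_{\mathbf i}\,x_{i_1}\cdots x_{i_d}.$$ For a real matrix $M$ and real $p\ge 2$ let $\|M\|_{p}=\big(\operatorname{tr}(M^{\mathsf T}M)^{p/2}\big)^{1/p}$ be its Schatten $p$-norm. For a matrix $G$ of polynomials let $G_{0,0,0}=G$, and let $G_{a+1,b,c}$, $G_{a,b+1,c}$, $G_{a,b,c+1}$ be the block matrices whose blocks are the formal partial derivatives $\partial_{x_1}G_{a,b,c},\dots,\partial_{x_n}G_{a,b,c}$,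 stacked vertically, stacked horizontally, and placed along the diagonal (with zero blocks elsewhere), respectively; the steps leading to $(a,b,c)$ may be taken in any order. If $a+b+c=d$, then $F^{=d}_{a,b,c}$ is a constant real matrix. Then for every real $t\ge 2$ the random variable $\|F(x)-\mathbb E F(x)\|_{4t}^{4t}$ is integrable and $$\mathbb E\,\|F(x)-\mathbb E F(x)\|_{4t}^{4t}\;\le\;\sum_{d=1}^D D^{4t}(48dt)^{4dt}\sum_{\substack{a,b,c\ge 0\\ a+b+c=d}}L^{4ct}\,\|F^{=d}_{a,b,c}\|_{4t}^{4t},$$ whatever order of steps is chosen for each $(a,b,c)$. The same inequality also holds if each $F^{=d}_{a,b,c}$ is replaced by the corresponding matrix formed from the decoupled polynomial $\sum_{\mathbf i\in\mathcal T^d_n}A_{\mathbf i}\,x^{(1)}_{i_1}\cdots x^{(d)}_{i_d}$ in $d$ separate copies $x^{(1)},\dots,x^{(d)}$ of the variables, the $k$-th step differentiating with respect to $x^{(k)}_1,\dots,x^{(k)}_n$ (so that the blocks are the matrices $A_{\mathbf i}$ and zero matrices). -/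

import Mathlib

open MeasureTheory ProbabilityTheory

/-- The Schatten `p`-norm `(tr (Aᵀ A) ^ (p / 2)) ^ (1 / p)` of a real matrix; the real power of the
positive semidefinite matrix `Aᵀ A` is taken by the functional calculus. -/
noncomputable def schattenNorm {m q : Type*} [Fintype m] [Fintype q] [DecidableEq q]
    (p : ℝ) (A : Matrix m q ℝ) : ℝ :=
  (Matrix.trace (cfc (fun s : ℝ => s ^ (p / 2)) (A.transpose * A))) ^ (1 / p)

/-- The three ways of assembling the partial derivatives `∂₁ G, …, ∂ₙ G` of a matrix `G` into a
block matrix: stacked vertically, stacked horizontally, or placed along the diagonal. -/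
inductive Step : Type
  | vert
  | horiz
  | diag
  deriving DecidableEq

/-- Row index of the block matrix obtained from a matrix with row index `m` by the steps of a
list; the head of the list is the last step. -/
def RowIdx (n : ℕ) (m : Type*) : List Step → Type _
  | [] => m
  | .vert :: w => Fin n × RowIdx n m w
  | .horiz :: w => RowIdx n m w
  | .diag :: w => Fin n × RowIdx n m w

/-- Column index of the block matrix obtained from a matrix with column index `q`. -/
def ColIdx (n : ℕ) (q : Type*) : List Step → Type _
  | [] => q
  | .vert :: w => ColIdx n q w
  | .horiz :: w => Fin n × ColIdx n q w
  | .diag :: w => Fin n × ColIdx n q w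

instance RowIdx.instFintype (n : ℕ) (m : Type*) [Fintype m] :
    (w : List Step) → Fintype (RowIdx n m w)
  | [] => inferInstanceAs (Fintype m)
  | .vert :: w =>
    letI := RowIdx.instFintype n m w
    inferInstanceAs (Fintype (Fin n × RowIdx n m w))
  | .horiz :: w => RowIdx.instFintype n m w
  | .diag :: w =>
    letI := RowIdx.instFintype n m w
    inferInstanceAs (Fintype (Fin n × RowIdx n m w))

instance ColIdx.instFintype (n : ℕ) (q : Type*) [Fintype q] :
    (w : List Step) → Fintype (ColIdx n q w)
  | [] => inferInstanceAs (Fintype q)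
  | .vert :: w => ColIdx.instFintype n q w
  | .horiz :: w =>
    letI := ColIdx.instFintype n q w
    inferInstanceAs (Fintype (Fin n × ColIdx n q w))
  | .diag :: w =>
    letI := ColIdx.instFintype n q w
    inferInstanceAs (Fintype (Fin n × ColIdx n q w))

instance ColIdx.instDecidableEq (n : ℕ) (q : Type*) [DecidableEq q] :
    (w : List Step) → DecidableEq (ColIdx n q w)
  | [] => inferInstanceAs (DecidableEq q)
  | .vert :: w => ColIdx.instDecidableEq n q w
  | .horiz :: w =>
    letI := ColIdx.instDecidableEq n q w
    inferInstanceAs (DecidableEq (Fin n × ColIdx n q w))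
  | .diag :: w =>
    letI := ColIdx.instDecidableEq n q w
    inferInstanceAs (DecidableEq (Fin n × ColIdx n q w))

/-- The block matrix of partial derivatives of a matrix `F` of polynomials, built by the steps of
a list (its head is the last step). The `k`-th step (`k = 0, 1, …`) differentiates with respect to
the `n` variables `v k 0, …, v k (n - 1)`; for the usual derivatives `v` does not depend on `k`. -/
noncomputable def derivMatrix {n : ℕ} {σ m q : Type*} (v : ℕ → Fin n → σ)
    (F : Matrix m q (MvPolynomial σ ℝ)) :
    (w : List Step) → Matrix (RowIdx n m w) (ColIdx n q w) (MvPolynomial σ ℝ)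
  | [] => F
  | .vert :: w => Matrix.of fun (i : Fin n × RowIdx n m w) (s : ColIdx n q w) =>
      MvPolynomial.pderiv (v w.length i.1) (derivMatrix v F w i.2 s)
  | .horiz :: w => Matrix.of fun (r : RowIdx n m w) (j : Fin n × ColIdx n q w) =>
      MvPolynomial.pderiv (v w.length j.1) (derivMatrix v F w r j.2)
  | .diag :: w => Matrix.of fun (i : Fin n × RowIdx n m w) (j : Fin n × ColIdx n q w) =>
      if i.1 = j.1 then MvPolynomial.pderiv (v w.length i.1) (derivMatrix v F w i.2 j.2) else 0

/-- A matrix of constant polynomials, as a real matrix. (The derivatives of order `d` of a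
homogeneous polynomial of degree `d` are constant.) -/
noncomputable def constMatrix {σ m q : Type*} (F : Matrix m q (MvPolynomial σ ℝ)) :
    Matrix m q ℝ :=
  F.map MvPolynomial.constantCoeff

/-- The `d`-tuples of pairwise distinct elements of `{0, …, n - 1}`. -/
abbrev DistinctTuple (d n : ℕ) : Type := Fin d ↪ Fin n

/-- Permutation symmetry of the coefficients `A i`, `i` a tuple of distinct indices. -/
def PermSymmetric {d n : ℕ} {m q : Type*} (A : DistinctTuple d n → Matrix m q ℝ) : Prop :=
  ∀ (π : Equiv.Perm (Fin d)) (i : DistinctTuple d n), A (π.toEmbedding.trans i) = A i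

/-- The homogeneous multilinear matrix polynomial `∑ i, A i * ∏ j, x (i j)`, the sum being over
all tuples of distinct indices. -/
noncomputable def homogPoly {d n : ℕ} {m q : Type*} (A : DistinctTuple d n → Matrix m q ℝ) :
    Matrix m q (MvPolynomial (Fin n) ℝ) :=
  Matrix.of fun r s => ∑ i : DistinctTuple d n,
    MvPolynomial.C (A i r s) * ∏ j : Fin d, MvPolynomial.X (i j)

/-- The decoupled form `∑ i, A i * ∏ j, x⁽ʲ⁾ (i j)`; the variable `(j, k)` is the `k`-th coordinate
of the `j`-th copy of the variables. -/
noncomputable def decoupledPoly {d n : ℕ} {m q : Type*} (A : DistinctTuple d n → Matrix m q ℝ) :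
    Matrix m q (MvPolynomial (ℕ × Fin n) ℝ) :=
  Matrix.of fun r s => ∑ i : DistinctTuple d n,
    MvPolynomial.C (A i r s) * ∏ j : Fin d, MvPolynomial.X ((j : ℕ), i j)

/-- The real matrix of `d`-th order partial derivatives of the degree-`d` homogeneous polynomial
with coefficients `A`, arranged by the `d` steps of `w`. -/
noncomputable def partialBlock {d n : ℕ} {m q : Type*} (A : DistinctTuple d n → Matrix m q ℝ)
    (w : List Step) : Matrix (RowIdx n m w) (ColIdx n q w) ℝ :=
  constMatrix (derivMatrix (fun _ k => k) (homogPoly A) w)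

/-- The same for the decoupled polynomial, the `k`-th step differentiating with respect to the
`k`-th copy of the variables. -/
noncomputable def decoupledBlock {d n : ℕ} {m q : Type*} (A : DistinctTuple d n → Matrix m q ℝ)
    (w : List Step) : Matrix (RowIdx n m w) (ColIdx n q w) ℝ :=
  constMatrix (derivMatrix Prod.mk (decoupledPoly A) w)

/-- The multilinear matrix polynomial `∑_{d = 1}^D F^{=d}` with homogeneous parts of
coefficients `A d`. -/
noncomputable def multilinearPoly {n : ℕ} {m q : Type*} (D : ℕ)
    (A : (d : ℕ) → DistinctTuple d n → Matrix m q ℝ) : Matrix m q (MvPolynomial (Fin n) ℝ) :=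
  ∑ d ∈ Finset.Icc 1 D, homogPoly (A d)

/-- The value `F(x)` of a matrix polynomial. -/
noncomputable def evalMatrix {n : ℕ} {m q : Type*} (F : Matrix m q (MvPolynomial (Fin n) ℝ))
    (x : Fin n → ℝ) : Matrix m q ℝ :=
  F.map (MvPolynomial.eval x)

/-- The entrywise expectation of a random matrix. -/
noncomputable def expectedMatrix {Ω m q : Type*} [MeasurableSpace Ω] (μ : Measure Ω)
    (M : Ω → Matrix m q ℝ) : Matrix m q ℝ :=
  Matrix.of fun r s => ∫ ω, M ω r s ∂μ

/-- The triples `(a, b, c)` of natural numbers with `a + b + c = d`. -/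
def triples (d : ℕ) : Finset (ℕ × ℕ × ℕ) :=
  (Finset.range (d + 1) ×ˢ Finset.range (d + 1) ×ˢ Finset.range (d + 1)).filter
    fun u => u.1 + u.2.1 + u.2.2 = d

/-! ### Trace inequalities from pairs of spectra -/

section Spectral

variable {N : Type*} [Fintype N] [DecidableEq N]

/-! Since F has mean zero, convexity splits it into homogeneous parts at the cost of D^{4t}
(`schattenPow_sum_le`). A part of degree d is decoupled by colouring the variables with d colours
and keeping only the tuples whose j-th index has colour j. A tuple of distinct indices survives
under a fraction d^{-d} of all colourings, so the part is d^d times an average over colourings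
(`evalMatrix_homogPoly_eq_average`), and Jensen's inequality costs d^{4dt}. For a fixed colouring
the form is a d-fold nested sum over disjoint sets of independent variables, the coefficients of
each sum not involving the variables being summed.

Each layer is bounded by a matrix Rosenthal inequality, `integral_schattenPow_sum_le`, which
replaces ∑ x_k M_k by the vertical, horizontal and diagonal block matrices of the M_k, the last with
weight L^{2r}. Iteration produces a ternary tree whose leaves are words of d steps. The factor 3 on
the left of the Rosenthal inequality pays for the branching, so a bound common to all weighted
leaves suffices (`pow_mul_integral_schattenPow_stepBlock_colorEval_le`). Symmetry of the
coefficients makes the norm of a leaf depend only on the numbers (a, b, c) of steps of each kind, so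
the sum over triples is such a bound. With r = 2t a layer costs (48t)^{4t}, and d layers together
with the colouring cost (48dt)^{4dt}.

The Rosenthal inequality is proved by resampling. Dilation reduces it to symmetric H_k. For Y = ∑
x_k H_k one writes tr |Y|^{2q} = ∑ x_k tr(H_k f(Y)) with f(x) = x|x|^{2q-2}. The covariance of x_k
with tr(H_k f(Y)) is half the mean product of their increments when coordinate k is replaced by a
copy, and a mean value trace inequality bounds these increments. Young's inequality then isolates
half of tr |Y|^{2q}, which is absorbed, leaving ∑ H_k² and ∑ x_k² H_k². The second sum is treated by
the same method. The trace inequalities for noncommuting matrices are reduced to scalar ones by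
`exists_weights_trace_cfc_mul_cfc`.

Finally, the leaves are exactly the derivative blocks of the decoupled polynomial, and the ordinary
derivative blocks are d! times larger (`decoupledBlock_eq`, `partialBlock_eq`). -/

theorem Matrix.IsHermitian.cfc_eq_mul_diagonal_mul {A : Matrix N N ℝ} (hA : A.IsHermitian)
    (f : ℝ → ℝ) : cfc f A = (hA.eigenvectorUnitary : Matrix N N ℝ) *
      Matrix.diagonal (fun j => f (hA.eigenvalues j)) *
        (hA.eigenvectorUnitary : Matrix N N ℝ).transpose := by
  rw [hA.cfc_eq, Matrix.IsHermitian.cfc, Unitary.conjStarAlgAut_apply, Matrix.star_eq_conjTranspose,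
    Matrix.conjTranspose_eq_transpose_of_trivial]
  rfl

/-- The trace of a product of functions of two symmetric matrices is a nonnegative combination of
the products of values at pairs of eigenvalues. -/
theorem exists_weights_trace_cfc_mul_cfc {A B : Matrix N N ℝ} (hA : A.IsHermitian)
    (hB : B.IsHermitian) : ∃ w : N → N → ℝ, (∀ j k, 0 ≤ w j k) ∧ ∀ f g : ℝ → ℝ,
      (cfc f A * cfc g B).trace =
        ∑ j, ∑ k, w j k * (f (hA.eigenvalues j) * g (hB.eigenvalues k)) := by
  set U : Matrix N N ℝ := (hA.eigenvectorUnitary : Matrix N N ℝ)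
  set V : Matrix N N ℝ := (hB.eigenvectorUnitary : Matrix N N ℝ)
  -- The weights are the squared overlaps of the two eigenbases; they do not depend on f and g.
  refine ⟨fun j k => (U.transpose * V) j k ^ 2, fun j k => sq_nonneg _, fun f g => ?_⟩
  rw [hA.cfc_eq_mul_diagonal_mul, hB.cfc_eq_mul_diagonal_mul]
  set P := Matrix.diagonal (fun j => f (hA.eigenvalues j))
  set Q := Matrix.diagonal (fun j => g (hB.eigenvalues j))
  have h : (U * P * U.transpose * (V * Q * V.transpose)).trace =
      ((P * (U.transpose * V)) * (Q * (U.transpose * V).transpose)).trace := by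
    rw [Matrix.transpose_mul, Matrix.transpose_transpose]
    calc _ = (U * (P * U.transpose * V * Q * V.transpose)).trace := by
          simp only [Matrix.mul_assoc]
      _ = _ := by rw [Matrix.trace_mul_comm]; simp only [Matrix.mul_assoc]
  rw [h]
  simp only [Matrix.trace, Matrix.diag_apply, Matrix.mul_apply (M := P * _), P, Q,
    Matrix.diagonal_mul, Matrix.transpose_apply]
  exact Finset.sum_congr rfl fun j _ => Finset.sum_congr rfl fun k _ => by ring

theorem continuousOn_spectrum_of_matrix (f : ℝ → ℝ) (A : Matrix N N ℝ) :
    ContinuousOn f (spectrum ℝ A) :=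
  (Matrix.finite_real_spectrum (A := A)).continuousOn f

theorem cfc_mul_cfc {A : Matrix N N ℝ} (f g : ℝ → ℝ) :
    cfc f A * cfc g A = cfc (fun s => f s * g s) A :=
  (cfc_mul f g A (continuousOn_spectrum_of_matrix f A) (continuousOn_spectrum_of_matrix g A)).symm

theorem Matrix.IsHermitian.mul_cfc {A : Matrix N N ℝ} (hA : A.IsHermitian) (f : ℝ → ℝ) :
    A * cfc f A = cfc (fun s => s * f s) A := by
  have := cfc_mul_cfc (A := A) (fun s => s) f
  rwa [cfc_id' ℝ A hA.isSelfAdjoint] at this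

theorem Matrix.IsHermitian.cfc_mul {A : Matrix N N ℝ} (hA : A.IsHermitian) (f : ℝ → ℝ) :
    cfc f A * A = cfc (fun s => s * f s) A := by
  have := cfc_mul_cfc (A := A) f (fun s => s)
  rw [cfc_id' ℝ A hA.isSelfAdjoint] at this
  simpa only [mul_comm] using this

theorem Matrix.IsHermitian.sq_eq_cfc {A : Matrix N N ℝ} (hA : A.IsHermitian) :
    A * A = cfc (fun s : ℝ => s ^ 2) A := by
  rw [cfc_pow_id (R := ℝ) A 2 hA.isSelfAdjoint, sq]

theorem Matrix.IsHermitian.cfc_one_eq {A : Matrix N N ℝ} (hA : A.IsHermitian) :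
    cfc (fun _ => (1 : ℝ)) A = 1 := cfc_const_one ℝ A hA.isSelfAdjoint

/-- The transfer principle behind the matrix Young inequalities: the weights are nonnegative, so a
separable scalar inequality need only hold at pairs of eigenvalues, although the matrices need not
commute. -/
theorem trace_cfc_mul_cfc_le_add {A B : Matrix N N ℝ} (hA : A.IsHermitian) (hB : B.IsHermitian)
    {f₁ f₂ f₃ g₁ g₂ g₃ : ℝ → ℝ} (h : ∀ j k, f₁ (hA.eigenvalues j) * g₁ (hB.eigenvalues k) ≤
      f₂ (hA.eigenvalues j) * g₂ (hB.eigenvalues k) +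
        f₃ (hA.eigenvalues j) * g₃ (hB.eigenvalues k)) :
    (cfc f₁ A * cfc g₁ B).trace ≤ (cfc f₂ A * cfc g₂ B).trace + (cfc f₃ A * cfc g₃ B).trace := by
  obtain ⟨w, hw, hwt⟩ := exists_weights_trace_cfc_mul_cfc hA hB
  simp only [hwt, ← Finset.sum_add_distrib, ← mul_add]
  exact Finset.sum_le_sum fun j _ => Finset.sum_le_sum fun k _ =>
    mul_le_mul_of_nonneg_left (h j k) (hw j k)

/-- The mean value trace inequality. -/
theorem trace_sub_mul_cfc_sub_le {A B : Matrix N N ℝ} (hA : A.IsHermitian) (hB : B.IsHermitian)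
    (f g : ℝ → ℝ) (h : ∀ j k, (hA.eigenvalues j - hB.eigenvalues k) *
      (f (hA.eigenvalues j) - f (hB.eigenvalues k)) ≤
        (hA.eigenvalues j - hB.eigenvalues k) ^ 2 *
          (g (hA.eigenvalues j) + g (hB.eigenvalues k))) :
    ((A - B) * (cfc f A - cfc f B)).trace ≤
      ((A - B) * (A - B) * (cfc g A + cfc g B)).trace := by
  obtain ⟨w, hw, hwt⟩ := exists_weights_trace_cfc_mul_cfc hA hB
  have hid : ∀ {C : Matrix N N ℝ}, C.IsHermitian → cfc (fun s : ℝ => s) C = C :=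
    fun hC => cfc_id' ℝ _ hC.isSelfAdjoint
  -- By cyclicity each term on either side becomes the trace of a function of A times a function of
  -- B, with the constant function one where a matrix is absent. One family of weights then serves
  -- for all terms.
  have e1 : (A * cfc f A).trace = (cfc (fun s => s * f s) A * cfc (fun _ => (1 : ℝ)) B).trace := by
    rw [hA.mul_cfc, hB.cfc_one_eq, mul_one]
  have e2 : (B * cfc f B).trace = (cfc (fun _ => (1 : ℝ)) A * cfc (fun s => s * f s) B).trace := by
    rw [hB.mul_cfc, hA.cfc_one_eq, one_mul]
  have e3 : (A * cfc f B).trace = (cfc (fun s : ℝ => s) A * cfc f B).trace := by rw [hid hA]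
  have e4 : (B * cfc f A).trace = (cfc f A * cfc (fun s : ℝ => s) B).trace := by
    rw [hid hB, Matrix.trace_mul_comm]
  have e5 : (A * A * cfc g A).trace = (cfc (fun s => s ^ 2 * g s) A * cfc (fun _ => (1 : ℝ)) B).trace := by
    rw [hA.sq_eq_cfc, cfc_mul_cfc, hB.cfc_one_eq, mul_one]
  have e6 : (A * B * cfc g A).trace = (cfc (fun s => s * g s) A * cfc (fun s : ℝ => s) B).trace := by
    rw [hid hB, Matrix.trace_mul_comm, ← Matrix.mul_assoc, hA.cfc_mul]
  have e7 : (B * A * cfc g A).trace = (cfc (fun s => s * g s) A * cfc (fun s : ℝ => s) B).trace := by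
    rw [hid hB, Matrix.mul_assoc, hA.mul_cfc, Matrix.trace_mul_comm]
  have e8 : (B * B * cfc g A).trace = (cfc g A * cfc (fun s : ℝ => s ^ 2) B).trace := by
    rw [hB.sq_eq_cfc, Matrix.trace_mul_comm]
  have e9 : (A * A * cfc g B).trace = (cfc (fun s : ℝ => s ^ 2) A * cfc g B).trace := by
    rw [hA.sq_eq_cfc]
  have e10 : (A * B * cfc g B).trace = (cfc (fun s : ℝ => s) A * cfc (fun s => s * g s) B).trace := by
    rw [hid hA, Matrix.mul_assoc, hB.mul_cfc]
  have e11 : (B * A * cfc g B).trace = (cfc (fun s : ℝ => s) A * cfc (fun s => s * g s) B).trace := by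
    rw [hid hA, Matrix.trace_mul_comm, ← Matrix.mul_assoc, hB.cfc_mul, Matrix.trace_mul_comm]
  have e12 : (B * B * cfc g B).trace = (cfc (fun _ => (1 : ℝ)) A * cfc (fun s => s ^ 2 * g s) B).trace := by
    rw [hB.sq_eq_cfc, cfc_mul_cfc, hA.cfc_one_eq, one_mul]
  have l : ((A - B) * (cfc f A - cfc f B)).trace = (A * cfc f A).trace - (A * cfc f B).trace
      - (B * cfc f A).trace + (B * cfc f B).trace := by
    simp only [sub_mul, mul_sub, Matrix.trace_sub]; ring
  have r : ((A - B) * (A - B) * (cfc g A + cfc g B)).trace =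
      (A * A * cfc g A).trace - (A * B * cfc g A).trace - (B * A * cfc g A).trace
      + (B * B * cfc g A).trace + ((A * A * cfc g B).trace - (A * B * cfc g B).trace
      - (B * A * cfc g B).trace + (B * B * cfc g B).trace) := by
    simp only [sub_mul, mul_sub, Matrix.trace_sub, mul_add, Matrix.trace_add]; ring
  rw [l, r, e1, e2, e3, e4, e5, e6, e7, e8, e9, e10, e11, e12]
  simp only [hwt, ← Finset.sum_sub_distrib, ← Finset.sum_add_distrib]
  refine Finset.sum_le_sum fun j _ => Finset.sum_le_sum fun k _ => ?_
  have := mul_le_mul_of_nonneg_left (h j k) (hw j k)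
  nlinarith [this]

/-- Klein's inequality. -/
theorem trace_cfc_add_trace_sub_mul_cfc_le {A B : Matrix N N ℝ} (hA : A.IsHermitian)
    (hB : B.IsHermitian) (f g : ℝ → ℝ) (h : ∀ j k, f (hB.eigenvalues k) +
      (hA.eigenvalues j - hB.eigenvalues k) * g (hB.eigenvalues k) ≤ f (hA.eigenvalues j)) :
    (cfc f B).trace + ((A - B) * cfc g B).trace ≤ (cfc f A).trace := by
  obtain ⟨w, hw, hwt⟩ := exists_weights_trace_cfc_mul_cfc hA hB
  have hid : ∀ {C : Matrix N N ℝ}, C.IsHermitian → cfc (fun s : ℝ => s) C = C :=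
    fun hC => cfc_id' ℝ _ hC.isSelfAdjoint
  have e1 : (cfc f B).trace = (cfc (fun _ => (1 : ℝ)) A * cfc f B).trace := by
    rw [hA.cfc_one_eq, one_mul]
  have e2 : (cfc f A).trace = (cfc f A * cfc (fun _ => (1 : ℝ)) B).trace := by
    rw [hB.cfc_one_eq, mul_one]
  have e3 : ((A - B) * cfc g B).trace = (cfc (fun s : ℝ => s) A * cfc g B).trace -
      (cfc (fun _ => (1 : ℝ)) A * cfc (fun s => s * g s) B).trace := by
    rw [hid hA, hA.cfc_one_eq, one_mul, sub_mul, Matrix.trace_sub, hB.mul_cfc]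
  rw [e1, e2, e3]
  simp only [hwt, ← Finset.sum_sub_distrib, ← Finset.sum_add_distrib]
  refine Finset.sum_le_sum fun j _ => Finset.sum_le_sum fun k _ => ?_
  have := mul_le_mul_of_nonneg_left (h j k) (hw j k)
  nlinarith [this]

theorem trace_mul_cfc_nonneg {A B : Matrix N N ℝ} (hA : A.PosSemidef) (hB : B.IsHermitian)
    (g : ℝ → ℝ) (hg : ∀ k, 0 ≤ g (hB.eigenvalues k)) : 0 ≤ (A * cfc g B).trace := by
  obtain ⟨w, hw, hwt⟩ := exists_weights_trace_cfc_mul_cfc hA.1 hB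
  have := hwt (fun s => s) g
  rw [cfc_id' ℝ A hA.1.isSelfAdjoint] at this
  rw [this]
  exact Finset.sum_nonneg fun j _ => Finset.sum_nonneg fun k _ =>
    mul_nonneg (hw _ _) (mul_nonneg (hA.eigenvalues_nonneg j) (hg k))

theorem trace_cfc_eq_sum {A : Matrix N N ℝ} (hA : A.IsHermitian) (f : ℝ → ℝ) :
    (cfc f A).trace = ∑ j, f (hA.eigenvalues j) := by
  rw [hA.cfc_eq_mul_diagonal_mul, Matrix.trace_mul_comm, ← Matrix.mul_assoc]
  have : (hA.eigenvectorUnitary : Matrix N N ℝ).transpose * (hA.eigenvectorUnitary : Matrix N N ℝ)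
      = 1 := by
    rw [← Matrix.conjTranspose_eq_transpose_of_trivial, ← Matrix.star_eq_conjTranspose]
    exact Unitary.coe_star_mul_self _
  rw [this, one_mul, Matrix.trace_diagonal]

-- Makes every trace functional below a continuous function of the coordinates, hence integrable
-- under boundedly supported laws.
open scoped Matrix.Norms.L2Operator in
theorem continuous_cfc_comp {X : Type*} [TopologicalSpace X] {f : ℝ → ℝ} (hf : Continuous f)
    {A : X → Matrix N N ℝ} (hA : Continuous A) (hA' : ∀ x, (A x).IsHermitian) :
    Continuous fun x => cfc f (A x) :=
  hA.cfc_of_mem_nhdsSet (s := Set.univ) f Filter.univ_mem (fun x => (hA' x).isSelfAdjoint)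
    hf.continuousOn

end Spectral

/-! ### Scalar inequalities for real powers -/

section Scalar

/-- Bernoulli's inequality at x / y - 1, scaled by y ^ s. -/
theorem rpow_tangent_le {s x y : ℝ} (hs : 1 < s) (hx : 0 ≤ x) (hy : 0 ≤ y) :
    y ^ s + (x - y) * (s * y ^ (s - 1)) ≤ x ^ s := by
  rcases hy.eq_or_lt with rfl | hy
  · rw [Real.zero_rpow (by linarith), Real.zero_rpow (by linarith)]
    simpa using Real.rpow_nonneg hx s
  · have h := one_add_mul_self_le_rpow_one_add (s := x / y - 1) (p := s)
      (by have := div_nonneg hx hy.le; linarith) hs.le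
    rw [add_sub_cancel, Real.div_rpow hx hy.le, le_div_iff₀ (Real.rpow_pos_of_pos hy s)] at h
    refine le_trans (le_of_eq ?_) h
    rw [Real.rpow_sub_one hy.ne']
    field_simp

theorem abs_rpow_tangent_le {s : ℝ} (hs : 2 < s) (x y : ℝ) :
    |y| ^ s + (x - y) * (s * (y * |y| ^ (s - 2))) ≤ |x| ^ s := by
  refine le_trans ?_ (rpow_tangent_le (by linarith) (abs_nonneg x) (abs_nonneg y))
  have h1 : |y| ^ (s - 1) = |y| * |y| ^ (s - 2) := by
    rcases (abs_nonneg y).eq_or_lt with h | h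
    · rw [← h, Real.zero_rpow (by linarith)]; simp
    · rw [← Real.rpow_one_add' h.le (by linarith)]; congr 1; ring
  rw [h1]
  have h2 : (x - y) * y ≤ (|x| - |y|) * |y| := by
    have := le_abs_self (x * y)
    rw [abs_mul] at this
    nlinarith [abs_mul_abs_self y]
  have h3 : 0 ≤ s * |y| ^ (s - 2) := mul_nonneg (by linarith) (Real.rpow_nonneg (abs_nonneg y) _)
  nlinarith [mul_le_mul_of_nonneg_right h2 h3]

theorem mul_abs_rpow_eq {r x : ℝ} (hr : 0 < r) (hx : 0 ≤ x) : x * |x| ^ r = x ^ (r + 1) := by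
  rw [abs_of_nonneg hx, add_comm, Real.rpow_one_add' hx (by linarith)]

/-- For equal signs, convexity is used at the point of larger modulus; for opposite signs the cross
terms are estimated directly. The derivative bound is a sum of a function of a and a function of b,
the separable form that the trace transfer needs. -/
theorem sub_mul_mul_abs_rpow_sub_le {r : ℝ} (hr : 0 < r) (a b : ℝ) :
    (a - b) * (a * |a| ^ r - b * |b| ^ r) ≤ (a - b) ^ 2 * ((r + 1) * |a| ^ r + (r + 1) * |b| ^ r) := by
  have key : ∀ x y : ℝ, 0 ≤ x → 0 ≤ y → (x - y) * (x ^ (r + 1) - y ^ (r + 1)) ≤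
      (x - y) ^ 2 * ((r + 1) * x ^ r + (r + 1) * y ^ r) := by
    have : ∀ x y : ℝ, 0 ≤ y → y ≤ x → (x - y) * (x ^ (r + 1) - y ^ (r + 1)) ≤
        (x - y) ^ 2 * ((r + 1) * x ^ r + (r + 1) * y ^ r) := by
      intro x y hy hxy
      have h := rpow_tangent_le (s := r + 1) (by linarith) hy (hy.trans hxy)
      rw [add_sub_cancel_right] at h
      have h1 : x ^ (r + 1) - y ^ (r + 1) ≤ (x - y) * ((r + 1) * x ^ r) := by linarith
      have h2 : 0 ≤ (r + 1) * y ^ r := mul_nonneg (by linarith) (Real.rpow_nonneg hy _)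
      nlinarith [mul_le_mul_of_nonneg_left h1 (sub_nonneg.2 hxy),
        mul_nonneg (sq_nonneg (x - y)) h2]
    intro x y hx hy
    rcases le_total y x with h | h
    · exact this x y hy h
    · have := this y x hx h
      linarith
  have opp : ∀ x y : ℝ, 0 ≤ x → y ≤ 0 → (x - y) * (x * |x| ^ r - y * |y| ^ r) ≤
      (x - y) ^ 2 * ((r + 1) * |x| ^ r + (r + 1) * |y| ^ r) := by
    intro x y hx hy
    have h1 : 0 ≤ |x| ^ r := Real.rpow_nonneg (abs_nonneg x) _
    have h2 : 0 ≤ |y| ^ r := Real.rpow_nonneg (abs_nonneg y) _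
    have h3 : x * |x| ^ r - y * |y| ^ r ≤ (x - y) * ((r + 1) * |x| ^ r + (r + 1) * |y| ^ r) := by
      nlinarith [mul_nonneg hx h2, mul_nonneg (neg_nonneg.2 hy) h1, mul_nonneg hx h1,
        mul_nonneg (neg_nonneg.2 hy) h2, mul_nonneg hr.le (mul_nonneg hx h2),
        mul_nonneg hr.le (mul_nonneg (neg_nonneg.2 hy) h1), mul_nonneg hr.le (mul_nonneg hx h1),
        mul_nonneg hr.le (mul_nonneg (neg_nonneg.2 hy) h2)]
    nlinarith [mul_le_mul_of_nonneg_left h3 (by linarith : 0 ≤ x - y)]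
  rcases le_total 0 a with ha | ha <;> rcases le_total 0 b with hb | hb
  · rw [mul_abs_rpow_eq hr ha, mul_abs_rpow_eq hr hb, abs_of_nonneg ha, abs_of_nonneg hb]
    exact key a b ha hb
  · exact opp a b ha hb
  · have := opp b a hb ha
    linarith
  · have := key (-a) (-b) (by linarith) (by linarith)
    rw [← mul_abs_rpow_eq hr (by linarith), ← mul_abs_rpow_eq hr (by linarith), abs_neg, abs_neg]
      at this
    rw [abs_of_nonpos ha, abs_of_nonpos hb] at *
    nlinarith [this]

/-- A form of Young's inequality with the coefficient of the term to be absorbed fixed at 1/4. If z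
≥ 4κv the left side is at most that term; otherwise z may be replaced by 4κv. -/
theorem mul_rpow_le_quarter_add {r κ v z : ℝ} (hr : 0 < r) (hκ : 0 ≤ κ) (hv : 0 ≤ v) (hz : 0 ≤ z) :
    κ * v * z ^ r ≤ 1 / 4 * z ^ (r + 1) + (4 * κ) ^ (r + 1) * v ^ (r + 1) := by
  have hzr := Real.rpow_nonneg hz r
  have hu : 0 ≤ 4 * κ * v := by positivity
  rw [← Real.mul_rpow (by positivity) hv]
  rcases le_total (4 * κ * v) z with h | h
  · have h1 : κ * v * z ^ r ≤ 1 / 4 * z ^ (r + 1) := by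
      rw [add_comm, Real.rpow_one_add' hz (by linarith)]
      nlinarith [mul_le_mul_of_nonneg_right h hzr]
    have := Real.rpow_nonneg hu (r + 1)
    linarith
  · have h1 : κ * v * z ^ r ≤ (4 * κ * v) ^ (r + 1) := by
      rw [add_comm r 1, Real.rpow_one_add' hu (by linarith)]
      have h2 := Real.rpow_le_rpow hz h hr.le
      have h3 : κ * v ≤ 4 * κ * v := by nlinarith [mul_nonneg hκ hv]
      exact mul_le_mul h3 h2 hzr hu
    have := Real.rpow_nonneg hz (r + 1)
    linarith

theorem continuous_abs_rpow {s : ℝ} (hs : 0 ≤ s) : Continuous fun x : ℝ => |x| ^ s :=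
  continuous_abs.rpow_const fun _ => Or.inr hs

end Scalar

/-! ### Trace powers of symmetric matrices -/

section TracePower

variable {N : Type*} [Fintype N] [DecidableEq N]

/-- The trace of the `s`-th power of the absolute value of a symmetric matrix. -/
noncomputable def tracePow (s : ℝ) (A : Matrix N N ℝ) : ℝ := (cfc (fun x : ℝ => |x| ^ s) A).trace

theorem tracePow_nonneg (s : ℝ) {A : Matrix N N ℝ} (hA : A.IsHermitian) : 0 ≤ tracePow s A := by
  rw [tracePow, trace_cfc_eq_sum hA]
  exact Finset.sum_nonneg fun j _ => Real.rpow_nonneg (abs_nonneg _) _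

theorem tracePow_eq_trace_mul {s : ℝ} (hs : 2 < s) {A : Matrix N N ℝ} (hA : A.IsHermitian) :
    tracePow s A = (A * cfc (fun x : ℝ => x * |x| ^ (s - 2)) A).trace := by
  rw [hA.mul_cfc, tracePow]
  congr 3
  ext x
  rw [← mul_assoc, ← abs_mul_abs_self x]
  rcases (abs_nonneg x).eq_or_lt with h | h
  · rw [← h, Real.zero_rpow (by linarith)]; simp
  · rw [← sq, ← Real.rpow_natCast, ← Real.rpow_add h]; congr 1; push_cast; ring

theorem trace_sub_mul_cfc_mul_abs_rpow_sub_le {r : ℝ} (hr : 0 < r) {A B : Matrix N N ℝ}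
    (hA : A.IsHermitian) (hB : B.IsHermitian) :
    ((A - B) * (cfc (fun x : ℝ => x * |x| ^ r) A - cfc (fun x : ℝ => x * |x| ^ r) B)).trace ≤
      (r + 1) * ((A - B) * (A - B) *
        (cfc (fun x : ℝ => |x| ^ r) A + cfc (fun x : ℝ => |x| ^ r) B)).trace := by
  have h := trace_sub_mul_cfc_sub_le hA hB (fun x => x * |x| ^ r) (fun x => (r + 1) * |x| ^ r)
    fun j k => sub_mul_mul_abs_rpow_sub_le hr _ _
  refine h.trans (le_of_eq ?_)
  have e : ∀ C : Matrix N N ℝ, cfc (fun x : ℝ => (r + 1) * |x| ^ r) C =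
      (r + 1) • cfc (fun x : ℝ => |x| ^ r) C := fun C =>
    cfc_const_mul (r + 1) (fun x : ℝ => |x| ^ r) C (continuousOn_spectrum_of_matrix _ _)
  rw [e, e, ← smul_add, Matrix.mul_smul, Matrix.trace_smul, smul_eq_mul]

theorem tracePow_tangent_le {s : ℝ} (hs : 2 < s) {A B : Matrix N N ℝ} (hA : A.IsHermitian)
    (hB : B.IsHermitian) :
    tracePow s B + ((A - B) * cfc (fun x : ℝ => s * (x * |x| ^ (s - 2))) B).trace ≤ tracePow s A :=
  trace_cfc_add_trace_sub_mul_cfc_le hA hB _ _ fun _ _ => abs_rpow_tangent_le hs _ _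

/-- The tangent inequality at B: its linear term pairs the positive semidefinite A - B with a
nonnegative function of B. -/
theorem tracePow_le_of_posSemidef_sub {s : ℝ} (hs : 2 < s) {A B : Matrix N N ℝ}
    (hB : B.PosSemidef) (hAB : (A - B).PosSemidef) : tracePow s B ≤ tracePow s A := by
  have hA : A.IsHermitian := by simpa using hAB.1.add hB.1
  have h := tracePow_tangent_le hs hA hB.1
  have := trace_mul_cfc_nonneg hAB hB.1 (fun x => s * (x * |x| ^ (s - 2))) fun k =>
    mul_nonneg (by linarith) (mul_nonneg (hB.eigenvalues_nonneg k)
      (Real.rpow_nonneg (abs_nonneg _) _))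
  linarith

/-- Young's inequality with v an eigenvalue of V and z the square of an eigenvalue of Y. -/
theorem mul_trace_mul_cfc_abs_rpow_le {q κ : ℝ} (hq : 1 < q) (hκ : 0 ≤ κ) {V Y : Matrix N N ℝ}
    (hV : V.PosSemidef) (hY : Y.IsHermitian) :
    κ * (V * cfc (fun x : ℝ => |x| ^ (2 * q - 2)) Y).trace ≤
      1 / 4 * tracePow (2 * q) Y + (4 * κ) ^ q * tracePow q V := by
  have h := trace_cfc_mul_cfc_le_add hV.1 hY (f₁ := fun x => κ * x) (g₁ := fun x => |x| ^ (2 * q - 2))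
    (f₂ := fun _ => 1 / 4) (g₂ := fun x => |x| ^ (2 * q)) (f₃ := fun x => (4 * κ) ^ q * |x| ^ q)
    (g₃ := fun _ => 1) (fun j k => by
      have h := mul_rpow_le_quarter_add (r := q - 1) (by linarith) hκ (hV.eigenvalues_nonneg j)
        (sq_nonneg |hY.eigenvalues k|)
      have e : ∀ t : ℝ, (|hY.eigenvalues k| ^ 2) ^ t = |hY.eigenvalues k| ^ (2 * t) := fun t => by
        rw [Real.rpow_mul (abs_nonneg _)]; norm_cast
      rw [e, e, sub_add_cancel, mul_sub, mul_one] at h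
      rw [abs_of_nonneg (hV.eigenvalues_nonneg j), mul_one]
      exact h)
  rw [hY.cfc_one_eq, mul_one, cfc_const_mul_id κ V hV.1.isSelfAdjoint, cfc_const _ _ hV.1.isSelfAdjoint,
    cfc_const_mul _ _ _ (continuousOn_spectrum_of_matrix _ _), Algebra.algebraMap_eq_smul_one] at h
  simpa [tracePow, Matrix.trace_smul] using h

theorem mul_trace_mul_cfc_mul_abs_rpow_le {q κ : ℝ} (hq : 2 < q) (hκ : 0 ≤ κ) {V Z : Matrix N N ℝ}
    (hV : V.PosSemidef) (hZ : Z.PosSemidef) :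
    κ * (V * cfc (fun x : ℝ => x * |x| ^ (q - 2)) Z).trace ≤
      1 / 4 * tracePow q Z + (4 * κ) ^ q * tracePow q V := by
  have h := trace_cfc_mul_cfc_le_add hV.1 hZ.1 (f₁ := fun x => κ * x)
    (g₁ := fun x => x * |x| ^ (q - 2))
    (f₂ := fun _ => 1 / 4) (g₂ := fun x => |x| ^ q) (f₃ := fun x => (4 * κ) ^ q * |x| ^ q)
    (g₃ := fun _ => 1) (fun j k => by
      have h := mul_rpow_le_quarter_add (r := q - 1) (by linarith) hκ (hV.eigenvalues_nonneg j)
        (hZ.eigenvalues_nonneg k)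
      rw [mul_abs_rpow_eq (by linarith) (hZ.eigenvalues_nonneg k), mul_one,
        abs_of_nonneg (hV.eigenvalues_nonneg j), abs_of_nonneg (hZ.eigenvalues_nonneg k),
        show q - 2 + 1 = q - 1 by ring]
      rwa [sub_add_cancel] at h)
  rw [hZ.1.cfc_one_eq, mul_one, cfc_const_mul_id κ V hV.1.isSelfAdjoint,
    cfc_const _ _ hV.1.isSelfAdjoint,
    cfc_const_mul _ _ _ (continuousOn_spectrum_of_matrix _ _), Algebra.algebraMap_eq_smul_one] at h
  simpa [tracePow, Matrix.trace_smul] using h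

/-- The scalar Young inequality with v = h² is multiplied by a further h². Keeping a factor H² in
the first term allows its weighted sum over k to reassemble the trace power being estimated. -/
theorem mul_trace_mul_self_mul_cfc_le {q κ : ℝ} (hq : 2 < q) (hκ : 0 ≤ κ) {H Z : Matrix N N ℝ}
    (hH : H.IsHermitian) (hZ : Z.PosSemidef) :
    κ * (H * H * (H * H) * cfc (fun x : ℝ => |x| ^ (q - 2)) Z).trace ≤
      1 / 4 * (H * H * cfc (fun x : ℝ => x * |x| ^ (q - 2)) Z).trace +
        (4 * κ) ^ (q - 1) * tracePow (2 * q) H := by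
  have h := trace_cfc_mul_cfc_le_add hH hZ.1 (f₁ := fun x => κ * (x ^ 2 * x ^ 2))
    (g₁ := fun x => |x| ^ (q - 2))
    (f₂ := fun x => 1 / 4 * x ^ 2) (g₂ := fun x => x * |x| ^ (q - 2))
    (f₃ := fun x => (4 * κ) ^ (q - 1) * |x| ^ (2 * q))
    (g₃ := fun _ => 1) (fun j k => by
      have h := mul_rpow_le_quarter_add (r := q - 2) (by linarith) hκ
        (sq_nonneg |hH.eigenvalues j|) (hZ.eigenvalues_nonneg k)
      have h := mul_le_mul_of_nonneg_left h (sq_nonneg |hH.eigenvalues j|)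
      have e : |hH.eigenvalues j| ^ (2 * q) =
          |hH.eigenvalues j| ^ 2 * (|hH.eigenvalues j| ^ 2) ^ (q - 1) := by
        have := Real.rpow_one_add' (x := |hH.eigenvalues j| ^ 2) (y := q - 1)
          (sq_nonneg _) (by linarith)
        rw [← this, add_sub_cancel, Real.rpow_mul (abs_nonneg _)]; norm_cast
      rw [mul_abs_rpow_eq (by linarith) (hZ.eigenvalues_nonneg k), mul_one, e,
        abs_of_nonneg (hZ.eigenvalues_nonneg k)]
      rw [show q - 2 + 1 = q - 1 by ring] at h ⊢
      rw [sq_abs] at h ⊢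
      linarith)
  rw [hZ.1.cfc_one_eq, mul_one, cfc_const_mul _ _ _ (continuousOn_spectrum_of_matrix _ _),
    cfc_const_mul _ _ _ (continuousOn_spectrum_of_matrix _ _),
    cfc_const_mul _ _ _ (continuousOn_spectrum_of_matrix _ _), ← cfc_mul_cfc, ← hH.sq_eq_cfc] at h
  simpa [tracePow, Matrix.trace_smul] using h

theorem continuous_tracePow_comp {X : Type*} [TopologicalSpace X] {s : ℝ} (hs : 0 ≤ s)
    {A : X → Matrix N N ℝ} (hA : Continuous A) (hA' : ∀ x, (A x).IsHermitian) :
    Continuous fun x => tracePow s (A x) :=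
  (continuous_cfc_comp (continuous_abs_rpow hs) hA hA').matrix_trace

end TracePower

/-! ### Bounded product laws and resampling of one coordinate -/

section Resample

theorem integrable_of_continuous_of_ae_mem_compact {X : Type*} [TopologicalSpace X]
    [MeasurableSpace X] [OpensMeasurableSpace X] {μ : Measure X} [IsFiniteMeasure μ] {K : Set X}
    (hK : IsCompact K) (h : ∀ᵐ x ∂μ, x ∈ K) {f : X → ℝ} (hf : Continuous f) : Integrable f μ := by
  obtain ⟨C, hC⟩ := hK.exists_bound_of_continuousOn hf.continuousOn
  exact Integrable.of_bound hf.measurable.aestronglyMeasurable C (h.mono fun x hx => hC x hx)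

/-- Probability measures on the line with mean zero, variance one and support in `[-L, L]`. -/
structure IsStandardBounded (L : ℝ) (ν : Measure ℝ) : Prop where
  isProbabilityMeasure : IsProbabilityMeasure ν
  ae_abs_le : ∀ᵐ s ∂ν, |s| ≤ L
  integral_id : ∫ s, s ∂ν = 0
  integral_sq : ∫ s, s ^ 2 ∂ν = 1

theorem IsStandardBounded.integrable {L : ℝ} {ν : Measure ℝ} (hν : IsStandardBounded L ν)
    {f : ℝ → ℝ} (hf : Continuous f) : Integrable f ν := by
  have := hν.isProbabilityMeasure
  refine integrable_of_continuous_of_ae_mem_compact (isCompact_Icc (a := -L) (b := L)) ?_ hf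
  exact hν.ae_abs_le.mono fun s hs => abs_le.1 hs

theorem IsStandardBounded.integral_pow_four_le {L : ℝ} {ν : Measure ℝ}
    (hν : IsStandardBounded L ν) : ∫ s, s ^ 4 ∂ν ≤ L ^ 2 := by
  have h : ∫ s, s ^ 4 ∂ν ≤ ∫ s, L ^ 2 * s ^ 2 ∂ν := by
    refine integral_mono_ae (hν.integrable (by fun_prop)) (hν.integrable (by fun_prop)) ?_
    filter_upwards [hν.ae_abs_le] with s hs
    have : s ^ 2 ≤ L ^ 2 := sq_le_sq' (by linarith [neg_abs_le s]) (le_trans (le_abs_self s) hs)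
    nlinarith [sq_nonneg s]
  rwa [integral_const_mul, hν.integral_sq, mul_one] at h

theorem IsStandardBounded.one_le {L : ℝ} {ν : Measure ℝ} (hν : IsStandardBounded L ν) :
    1 ≤ L := by
  have := hν.isProbabilityMeasure
  obtain ⟨s, hs⟩ := hν.ae_abs_le.exists
  have h0 : 0 ≤ L := (abs_nonneg s).trans hs
  have h : ∫ s, s ^ 2 ∂ν ≤ ∫ _, L ^ 2 ∂ν := by
    refine integral_mono_ae (hν.integrable (by fun_prop)) (integrable_const _) ?_
    filter_upwards [hν.ae_abs_le] with s hs
    exact sq_le_sq' (by linarith [neg_abs_le s]) (le_trans (le_abs_self s) hs)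
  rw [hν.integral_sq, integral_const] at h
  simp only [probReal_univ, smul_eq_mul, one_mul] at h
  nlinarith

/-- Covariance bound by comparison with an independent copy. -/
theorem IsStandardBounded.integral_mul_le {L : ℝ} {ν : Measure ℝ} (hν : IsStandardBounded L ν)
    {ρ G τ Ψ : ℝ → ℝ} (hρ : Continuous ρ) (hG : Continuous G) (hτ : Continuous τ)
    (hΨ : Continuous Ψ)
    (h : ∀ s s', (ρ s - ρ s') * (G s - G s') ≤ (τ s + τ s') * (Ψ s + Ψ s')) :
    ∫ s, ρ s * G s ∂ν ≤ (∫ s, ρ s ∂ν) * ∫ s, G s ∂ν + ∫ s, (τ s + ∫ s', τ s' ∂ν) * Ψ s ∂ν := by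
  have := hν.isProbabilityMeasure
  -- The expanded hypothesis is integrated over the copy s' only; integrating again over s yields
  -- twice the claim.
  have h1 : ∀ s, ρ s * G s - ρ s * (∫ s', G s' ∂ν) - G s * (∫ s', ρ s' ∂ν) + ∫ s', ρ s' * G s' ∂ν ≤
      τ s * Ψ s + τ s * (∫ s', Ψ s' ∂ν) + Ψ s * (∫ s', τ s' ∂ν) + ∫ s', τ s' * Ψ s' ∂ν := by
    intro s
    have e := integral_mono (μ := ν)
      (f := fun s' => ρ s * G s - ρ s * G s' - G s * ρ s' + ρ s' * G s')
      (g := fun s' => τ s * Ψ s + τ s * Ψ s' + Ψ s * τ s' + τ s' * Ψ s')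
      (hν.integrable (by fun_prop)) (hν.integrable (by fun_prop))
      (fun s' => by have := h s s'; dsimp only; linarith)
    rw [integral_add, integral_sub, integral_sub, integral_add, integral_add, integral_add] at e
    · simpa [integral_const_mul] using e
    all_goals exact hν.integrable (by fun_prop)
  have h2 := integral_mono (μ := ν) (hν.integrable (by fun_prop)) (hν.integrable (by fun_prop)) h1
  rw [integral_add, integral_sub, integral_sub, integral_add, integral_add, integral_add] at h2
  any_goals exact hν.integrable (by fun_prop)
  simp only [integral_mul_const, integral_const, probReal_univ, one_smul] at h2
  have h3 : ∫ s, (τ s + ∫ s', τ s' ∂ν) * Ψ s ∂ν =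
      ∫ s, τ s * Ψ s ∂ν + (∫ s', τ s' ∂ν) * ∫ s, Ψ s ∂ν := by
    simp only [add_mul]
    rw [integral_add, integral_const_mul]
    all_goals exact hν.integrable (by fun_prop)
  rw [h3]
  linarith

theorem ae_pi_abs_le {ι : Type*} [Fintype ι] {L : ℝ} {ν : ι → Measure ℝ}
    (hν : ∀ i, IsStandardBounded L (ν i)) :
    ∀ᵐ x ∂(Measure.pi ν), ∀ i, |x i| ≤ L := by
  have := fun i => (hν i).isProbabilityMeasure
  exact ae_all_iff.2 fun i =>
    (measurePreserving_eval ν i).quasiMeasurePreserving.ae (hν i).ae_abs_le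

theorem integrable_pi_of_continuous {ι : Type*} [Fintype ι] {L : ℝ} {ν : ι → Measure ℝ}
    (hν : ∀ i, IsStandardBounded L (ν i)) {f : (ι → ℝ) → ℝ}
    (hf : Continuous f) : Integrable f (Measure.pi ν) := by
  have := fun i => (hν i).isProbabilityMeasure
  refine integrable_of_continuous_of_ae_mem_compact
    (isCompact_univ_pi fun _ : ι => isCompact_Icc (a := -L) (b := L)) ?_ hf
  exact (ae_pi_abs_le hν).mono fun x hx i _ => abs_le.1 (hx i)

variable {ι : Type*} [Fintype ι] [DecidableEq ι]

/-- Checked on boxes: the discarded old coordinate contributes total mass one and the new one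
supplies the missing factor. -/
theorem measurePreserving_update (ν : ι → Measure ℝ) [∀ i, IsProbabilityMeasure (ν i)] (k : ι) :
    MeasurePreserving (fun z : (ι → ℝ) × ℝ => Function.update z.1 k z.2)
      ((Measure.pi ν).prod (ν k)) (Measure.pi ν) := by
  have hm : Measurable (fun z : (ι → ℝ) × ℝ => Function.update z.1 k z.2) := by
    refine measurable_pi_lambda _ fun j => ?_
    by_cases h : j = k
    · subst h; simpa using measurable_snd
    · simp only [Function.update_of_ne h]
      exact (measurable_pi_apply j).comp measurable_fst
  refine ⟨hm, (Measure.pi_eq fun S hS => ?_).symm⟩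
  rw [Measure.map_apply hm (MeasurableSet.univ_pi hS)]
  have : (fun z : (ι → ℝ) × ℝ => Function.update z.1 k z.2) ⁻¹' Set.univ.pi S =
      (Set.univ.pi (Function.update S k Set.univ)) ×ˢ S k := by
    ext ⟨x, s⟩
    simp only [Set.mem_preimage, Set.mem_pi, Set.mem_univ, true_implies, Set.mem_prod]
    constructor
    · refine fun h => ⟨fun j => ?_, by simpa using h k⟩
      by_cases hj : j = k
      · subst hj; simp
      · simpa [Function.update_of_ne hj] using h j
    · rintro ⟨h, hs⟩ j
      by_cases hj : j = k
      · subst hj; simpa using hs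
      · simpa [Function.update_of_ne hj] using h j
  rw [this, Measure.prod_prod, Measure.pi_pi, ← Finset.prod_erase_mul _ _ (Finset.mem_univ k),
    ← Finset.prod_erase_mul (a := k) _ (fun i => ν i (S i)) (Finset.mem_univ k)]
  simp only [Function.update_self, measure_univ, mul_one]
  congr 1
  refine Finset.prod_congr rfl fun j hj => ?_
  rw [Function.update_of_ne (Finset.ne_of_mem_erase hj)]

variable {L : ℝ} {ν : ι → Measure ℝ}

theorem integral_pi_eq_integral_update (hν : ∀ i, IsStandardBounded L (ν i)) (k : ι)
    {f : (ι → ℝ) → ℝ} (hf : Continuous f) :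
    ∫ x, f x ∂(Measure.pi ν) = ∫ x, ∫ s, f (Function.update x k s) ∂(ν k) ∂(Measure.pi ν) := by
  have := fun i => (hν i).isProbabilityMeasure
  have hm := measurePreserving_update ν k
  rw [← integral_prod (fun z : (ι → ℝ) × ℝ => f (Function.update z.1 k z.2))
    (hm.integrable_comp_of_integrable (integrable_pi_of_continuous hν hf)), ← hm.map_eq,
    integral_map hm.measurable.aemeasurable
      (by rw [hm.map_eq]; exact hf.measurable.aestronglyMeasurable), hm.map_eq]

theorem integrable_integral_update (hν : ∀ i, IsStandardBounded L (ν i)) (k : ι)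
    {f : (ι → ℝ) → ℝ} (hf : Continuous f) :
    Integrable (fun x => ∫ s, f (Function.update x k s) ∂(ν k)) (Measure.pi ν) := by
  have := fun i => (hν i).isProbabilityMeasure
  exact ((measurePreserving_update ν k).integrable_comp_of_integrable
    (integrable_pi_of_continuous hν hf)).integral_prod_left

/-- The one-dimensional covariance bound applied with the other coordinates frozen; the mean of ρ is
constant, so integrating over the rest restores the full mean of g. -/
theorem integral_coord_mul_le (hν : ∀ i, IsStandardBounded L (ν i)) (k : ι)
    {ρ τ : ℝ → ℝ} {g ψ : (ι → ℝ) → ℝ} (hρ : Continuous ρ) (hg : Continuous g) (hτ : Continuous τ)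
    (hψ : Continuous ψ)
    (h : ∀ x s, (ρ (x k) - ρ s) * (g x - g (Function.update x k s)) ≤
      (τ (x k) + τ s) * (ψ x + ψ (Function.update x k s))) :
    ∫ x, ρ (x k) * g x ∂(Measure.pi ν) ≤ (∫ s, ρ s ∂(ν k)) * ∫ x, g x ∂(Measure.pi ν) +
      ∫ x, (τ (x k) + ∫ s, τ s ∂(ν k)) * ψ x ∂(Measure.pi ν) := by
  have c1 : Continuous fun x : ι → ℝ => ρ (x k) * g x := by fun_prop
  have c2 : Continuous fun x : ι → ℝ => (τ (x k) + ∫ s, τ s ∂(ν k)) * ψ x := by fun_prop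
  rw [integral_pi_eq_integral_update hν k c1, integral_pi_eq_integral_update hν k hg,
    integral_pi_eq_integral_update hν k c2, ← integral_const_mul, ← integral_add
      ((integrable_integral_update hν k hg).const_mul _) (integrable_integral_update hν k c2)]
  refine integral_mono (integrable_integral_update hν k c1)
    (((integrable_integral_update hν k hg).const_mul _).add (integrable_integral_update hν k c2)) ?_
  intro x
  simp only [Function.update_self]
  have cu : Continuous fun s : ℝ => Function.update x k s := continuous_const.update k continuous_id
  refine (hν k).integral_mul_le hρ (hg.comp cu) hτ (hψ.comp cu) fun s s' => ?_
  simpa using h (Function.update x k s) s'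

end Resample

/-! ### Moments of sums of independent symmetric matrices -/

section Rosenthal

theorem Matrix.IsHermitian.posSemidef_mul_self {N : Type*} [Fintype N] {H : Matrix N N ℝ}
    (hH : H.IsHermitian) :
    (H * H).PosSemidef := by
  have := Matrix.posSemidef_conjTranspose_mul_self H
  rwa [hH.eq] at this

theorem Matrix.IsHermitian.smul_real {N : Type*} {H : Matrix N N ℝ} (hH : H.IsHermitian)
    (c : ℝ) :
    (c • H).IsHermitian := by
  rw [Matrix.IsHermitian, Matrix.conjTranspose_smul, hH.eq, star_trivial]

theorem isHermitian_sum {ι N : Type*} {I : Finset ι} {H : ι → Matrix N N ℝ}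
    (hH : ∀ k, (H k).IsHermitian) : (∑ k ∈ I, H k).IsHermitian := by
  rw [Matrix.IsHermitian, Matrix.conjTranspose_sum]
  exact Finset.sum_congr rfl fun k _ => hH k

theorem posSemidef_sum_smul_mul_self {ι N : Type*} [Fintype N] (I : Finset ι) {c : ι → ℝ} (hc : ∀ k, 0 ≤ c k)
    {H : ι → Matrix N N ℝ} (hH : ∀ k, (H k).IsHermitian) :
    (∑ k ∈ I, c k • (H k * H k)).PosSemidef :=
  Matrix.posSemidef_sum _ fun k _ => (hH k).posSemidef_mul_self.smul (hc k)

theorem sum_smul_update {ι N : Type*} [DecidableEq ι] (I : Finset ι) {k : ι} (hk : k ∈ I)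
    (ρ : ℝ → ℝ) (x : ι → ℝ) (s : ℝ)
    {H : ι → Matrix N N ℝ} : (∑ j ∈ I, ρ (x j) • H j) -
      ∑ j ∈ I, ρ (Function.update x k s j) • H j = (ρ (x k) - ρ s) • H k := by
  rw [← Finset.sum_sub_distrib, Finset.sum_eq_single_of_mem k hk, Function.update_self, sub_smul]
  intro j _ hj
  rw [Function.update_of_ne hj, sub_self]

theorem continuous_abs_odd_rpow {r : ℝ} (hr : 0 ≤ r) : Continuous fun x : ℝ => x * |x| ^ r :=
  continuous_id.mul (continuous_abs_rpow hr)

variable {ι : Type*} [Fintype ι] [DecidableEq ι] {L : ℝ} {ν : ι → Measure ℝ}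
  {N : Type*} [Fintype N] [DecidableEq N]

/-- Bound for the moments of a sum of independent centred matrices in terms of the conditional and
empirical variances. -/
theorem integral_tracePow_sum_le
    (hν : ∀ i, IsStandardBounded L (ν i)) (I : Finset ι) {H : ι → (ι → ℝ) → Matrix N N ℝ}
    (hH : ∀ k x, (H k x).IsHermitian) (hc : ∀ k, Continuous (H k))
    (hI : ∀ j ∈ I, ∀ k x s, H k (Function.update x j s) = H k x)
    {q : ℝ} (hq : 4 ≤ q) :
    ∫ x, tracePow (2 * q) (∑ k ∈ I, x k • H k x) ∂(Measure.pi ν) ≤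
      2 * (16 * q) ^ q * (∫ x, tracePow q (∑ k ∈ I, H k x * H k x) ∂(Measure.pi ν) +
        ∫ x, tracePow q (∑ k ∈ I, x k ^ 2 • (H k x * H k x)) ∂(Measure.pi ν)) := by
  set Y : (ι → ℝ) → Matrix N N ℝ := fun x => ∑ k ∈ I, x k • H k x with hYdef
  set Z : (ι → ℝ) → Matrix N N ℝ := fun x => ∑ k ∈ I, x k ^ 2 • (H k x * H k x) with hZdef
  set E : (ι → ℝ) → Matrix N N ℝ := fun x => ∑ k ∈ I, H k x * H k x with hEdef
  have hY : ∀ x, (Y x).IsHermitian := fun x => isHermitian_sum fun k => (hH k x).smul_real _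
  have hZ : ∀ x, (Z x).PosSemidef := fun x =>
    posSemidef_sum_smul_mul_self I (fun k => sq_nonneg (x k)) fun k => hH k x
  have hE : ∀ x, (E x).PosSemidef := fun x => by
    simpa using posSemidef_sum_smul_mul_self I (c := fun _ => 1) (fun k => zero_le_one)
      fun k => hH k x
  have cY : Continuous Y := by fun_prop
  have cZ : Continuous Z := by fun_prop
  have cE : Continuous E := by fun_prop
  have cf : Continuous fun x => cfc (fun t : ℝ => t * |t| ^ (2 * q - 2)) (Y x) :=
    continuous_cfc_comp (continuous_abs_odd_rpow (by linarith)) cY hY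
  have cg : Continuous fun x => cfc (fun t : ℝ => |t| ^ (2 * q - 2)) (Y x) :=
    continuous_cfc_comp (continuous_abs_rpow (by linarith)) cY hY
  -- Since x_k is centred, only the covariance survives. Resampling changes Y by a multiple of H_k,
  -- the mean value inequality gives the factor 2q - 1, and (x_k - s)² ≤ 2x_k² + 2s² dictates τ.
  have step : ∀ k ∈ I, ∫ x, x k * (H k x * cfc (fun t : ℝ => t * |t| ^ (2 * q - 2)) (Y x)).trace
      ∂(Measure.pi ν) ≤ ∫ x, (2 * x k ^ 2 + 2) * ((2 * q - 1) *
        (H k x * H k x * cfc (fun t : ℝ => |t| ^ (2 * q - 2)) (Y x)).trace) ∂(Measure.pi ν) := by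
    intro k hk
    have h := integral_coord_mul_le hν k (ρ := fun s => s) (τ := fun s => 2 * s ^ 2)
      (g := fun x => (H k x * cfc (fun t : ℝ => t * |t| ^ (2 * q - 2)) (Y x)).trace)
      (ψ := fun x => (2 * q - 1) *
        (H k x * H k x * cfc (fun t : ℝ => |t| ^ (2 * q - 2)) (Y x)).trace)
      continuous_id (by have := hc k; fun_prop) (by fun_prop) (by have := hc k; fun_prop) ?_
    · rw [(hν k).integral_id, zero_mul, zero_add, integral_const_mul, (hν k).integral_sq,
        mul_one] at h
      exact h
    · intro x s
      have hYu : Y x - Y (Function.update x k s) = (x k - s) • H k x := by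
        simp only [hYdef, hI k hk]
        exact sum_smul_update I hk (fun s => s) x s
      have h := trace_sub_mul_cfc_mul_abs_rpow_sub_le (r := 2 * q - 2) (by linarith) (hY x)
        (hY (Function.update x k s))
      rw [hYu] at h
      simp only [hI k hk]
      simp only [Matrix.smul_mul, Matrix.mul_smul, mul_sub, mul_add, Matrix.trace_smul,
        Matrix.trace_sub, Matrix.trace_add, smul_eq_mul] at h ⊢
      have n1 := trace_mul_cfc_nonneg (hH k x).posSemidef_mul_self (hY x)
        (fun t => |t| ^ (2 * q - 2)) fun _ => Real.rpow_nonneg (abs_nonneg _) _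
      have n2 := trace_mul_cfc_nonneg (hH k x).posSemidef_mul_self (hY (Function.update x k s))
        (fun t => |t| ^ (2 * q - 2)) fun _ => Real.rpow_nonneg (abs_nonneg _) _
      have n3 : (x k - s) ^ 2 ≤ 2 * x k ^ 2 + 2 * s ^ 2 := by nlinarith [sq_nonneg (x k + s)]
      have n4 := mul_le_mul_of_nonneg_right n3
        (mul_nonneg (by linarith : 0 ≤ 2 * q - 1) (add_nonneg n1 n2))
      linarith
  have hrep : ∀ x, tracePow (2 * q) (Y x) = ∑ k ∈ I,
      x k * (H k x * cfc (fun t : ℝ => t * |t| ^ (2 * q - 2)) (Y x)).trace := by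
    intro x
    rw [tracePow_eq_trace_mul (by linarith) (hY x)]
    nth_rewrite 1 [hYdef]
    simp only [Finset.sum_mul, Matrix.trace_sum, Matrix.smul_mul, Matrix.trace_smul, smul_eq_mul]
  have cT : Continuous fun x => tracePow (2 * q) (Y x) :=
    continuous_tracePow_comp (by linarith) cY hY
  have cTZ : Continuous fun x => tracePow q (Z x) :=
    continuous_tracePow_comp (by linarith) cZ fun x => (hZ x).1
  have cTE : Continuous fun x => tracePow q (E x) :=
    continuous_tracePow_comp (by linarith) cE fun x => (hE x).1
  have main : ∫ x, tracePow (2 * q) (Y x) ∂(Measure.pi ν) ≤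
      ∫ x, (1 / 2 * tracePow (2 * q) (Y x) + (16 * q) ^ q * (tracePow q (E x) + tracePow q (Z x)))
        ∂(Measure.pi ν) := by
    calc _ = ∑ k ∈ I, ∫ x, x k *
          (H k x * cfc (fun t : ℝ => t * |t| ^ (2 * q - 2)) (Y x)).trace ∂(Measure.pi ν) := by
          simp only [hrep]
          exact integral_finsetSum _ fun k _ => integrable_pi_of_continuous hν
            (by have := hc k; fun_prop)
      _ ≤ _ := Finset.sum_le_sum step
      _ = ∫ x, ∑ k ∈ I, (2 * x k ^ 2 + 2) * ((2 * q - 1) *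
          (H k x * H k x * cfc (fun t : ℝ => |t| ^ (2 * q - 2)) (Y x)).trace) ∂(Measure.pi ν) :=
          (integral_finsetSum _ fun k _ => integrable_pi_of_continuous hν
            (by have := hc k; fun_prop)).symm
      _ ≤ _ := by
          refine integral_mono (integrable_pi_of_continuous hν ?_)
            (integrable_pi_of_continuous hν (by fun_prop)) fun x => ?_
          · refine continuous_finsetSum _ fun k _ => ?_
            have := hc k
            fun_prop
          have e : ∑ k ∈ I, (2 * x k ^ 2 + 2) * ((2 * q - 1) *
              (H k x * H k x * cfc (fun t : ℝ => |t| ^ (2 * q - 2)) (Y x)).trace) =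
              2 * (2 * q - 1) * (E x * cfc (fun t : ℝ => |t| ^ (2 * q - 2)) (Y x)).trace +
              2 * (2 * q - 1) * (Z x * cfc (fun t : ℝ => |t| ^ (2 * q - 2)) (Y x)).trace := by
            simp only [hEdef, hZdef, Finset.sum_mul, Matrix.trace_sum, Finset.mul_sum,
              ← Finset.sum_add_distrib, Matrix.smul_mul, Matrix.trace_smul, smul_eq_mul]
            exact Finset.sum_congr rfl fun k _ => by ring
          dsimp only
          rw [e]
          have hκ : 0 ≤ 2 * (2 * q - 1) := by linarith
          have h1 := mul_trace_mul_cfc_abs_rpow_le (q := q) (by linarith) hκ (hE x) (hY x)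
          have h2 := mul_trace_mul_cfc_abs_rpow_le (q := q) (by linarith) hκ (hZ x) (hY x)
          have h3 : (4 * (2 * (2 * q - 1))) ^ q ≤ (16 * q) ^ q :=
            Real.rpow_le_rpow (by linarith) (by linarith) (by linarith)
          have h4 := mul_le_mul_of_nonneg_right h3
            (add_nonneg (tracePow_nonneg q (hE x).1) (tracePow_nonneg q (hZ x).1))
          linarith
  -- The two Young quarters sum to half of the finite left side; absorbing it doubles the constant.
  rw [integral_add, integral_const_mul, integral_const_mul, integral_add] at main
  · linarith
  all_goals exact integrable_pi_of_continuous hν (by fun_prop)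

/-- Moments of a sum of independent positive semidefinite matrices. -/
theorem integral_tracePow_sum_sq_le [Nonempty ι]
    (hν : ∀ i, IsStandardBounded L (ν i)) (I : Finset ι) {H : ι → (ι → ℝ) → Matrix N N ℝ}
    (hH : ∀ k x, (H k x).IsHermitian) (hc : ∀ k, Continuous (H k))
    (hI : ∀ j ∈ I, ∀ k x s, H k (Function.update x j s) = H k x)
    {q : ℝ} (hq : 4 ≤ q) :
    ∫ x, tracePow q (∑ k ∈ I, x k ^ 2 • (H k x * H k x)) ∂(Measure.pi ν) ≤
      2 * 5 ^ q * ∫ x, tracePow q (∑ k ∈ I, H k x * H k x) ∂(Measure.pi ν) +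
        (4 * q * L ^ 2) ^ q * ∑ k ∈ I, ∫ x, tracePow (2 * q) (H k x) ∂(Measure.pi ν) := by
  have hL : 1 ≤ L := (hν (Classical.arbitrary ι)).one_le
  set Z : (ι → ℝ) → Matrix N N ℝ := fun x => ∑ k ∈ I, x k ^ 2 • (H k x * H k x) with hZdef
  set E : (ι → ℝ) → Matrix N N ℝ := fun x => ∑ k ∈ I, H k x * H k x with hEdef
  have hZ : ∀ x, (Z x).PosSemidef := fun x =>
    posSemidef_sum_smul_mul_self I (fun k => sq_nonneg (x k)) fun k => hH k x
  have hE : ∀ x, (E x).PosSemidef := fun x => by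
    simpa using posSemidef_sum_smul_mul_self I (c := fun _ => 1) (fun k => zero_le_one)
      fun k => hH k x
  have cZ : Continuous Z := by fun_prop
  have cE : Continuous E := by fun_prop
  have cf : Continuous fun x => cfc (fun t : ℝ => t * |t| ^ (q - 2)) (Z x) :=
    continuous_cfc_comp (continuous_abs_odd_rpow (by linarith)) cZ fun x => (hZ x).1
  have cg : Continuous fun x => cfc (fun t : ℝ => |t| ^ (q - 2)) (Z x) :=
    continuous_cfc_comp (continuous_abs_rpow (by linarith)) cZ fun x => (hZ x).1
  have cTZ : Continuous fun x => tracePow q (Z x) :=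
    continuous_tracePow_comp (by linarith) cZ fun x => (hZ x).1
  have cTE : Continuous fun x => tracePow q (E x) :=
    continuous_tracePow_comp (by linarith) cE fun x => (hE x).1
  have cTH : ∀ k, Continuous fun x => tracePow (2 * q) (H k x) := fun k =>
    continuous_tracePow_comp (by linarith) (hc k) (hH k)
  -- The factor q - 1 comes from the mean value inequality, L² from x_k⁴ + E s⁴ ≤ (x_k² + 1) L².
  set κ : ℝ := L ^ 2 * (q - 1) with hκdef
  have hκ : 0 ≤ κ := mul_nonneg (sq_nonneg L) (by linarith)
  set K : ℝ := (L ^ 2 + 1) * (4 * κ) ^ (q - 1) with hKdef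
  -- Since L ≥ 1, 2(L² + 1) ≤ 4qL² supplies the missing factor of the q-th power.
  have hK : 2 * K ≤ (4 * q * L ^ 2) ^ q := by
    have h1 : (4 * κ) ^ (q - 1) ≤ (4 * q * L ^ 2) ^ (q - 1) :=
      Real.rpow_le_rpow (by linarith) (by nlinarith [sq_nonneg L]) (by linarith)
    have h2 : (4 * q * L ^ 2) ^ q = (4 * q * L ^ 2) * (4 * q * L ^ 2) ^ (q - 1) := by
      rw [← Real.rpow_one_add' (by positivity) (by linarith), add_sub_cancel]
    rw [h2, hKdef, ← mul_assoc]
    refine mul_le_mul (by nlinarith) h1 (Real.rpow_nonneg (by linarith) _) (by positivity)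
  -- In 5/4, the 1 is the product of means (variance one) and the 1/4 comes from Young's inequality
  -- weighted by x_k² + 1. The x_k² share of that weight sums to a quarter of the trace power of Z.
  have step : ∀ k ∈ I, ∫ x, x k ^ 2 *
      (H k x * H k x * cfc (fun t : ℝ => t * |t| ^ (q - 2)) (Z x)).trace ∂(Measure.pi ν) ≤
      ∫ x, (5 / 4 * (H k x * H k x * cfc (fun t : ℝ => t * |t| ^ (q - 2)) (Z x)).trace +
        1 / 4 * (x k ^ 2 * (H k x * H k x * cfc (fun t : ℝ => t * |t| ^ (q - 2)) (Z x)).trace) +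
        K * tracePow (2 * q) (H k x)) ∂(Measure.pi ν) := by
    intro k hk
    have ck := hc k
    have cTk := cTH k
    have h := integral_coord_mul_le hν k (ρ := fun s => s ^ 2) (τ := fun s => s ^ 4)
      (g := fun x => (H k x * H k x * cfc (fun t : ℝ => t * |t| ^ (q - 2)) (Z x)).trace)
      (ψ := fun x => (q - 1) *
        (H k x * H k x * (H k x * H k x) * cfc (fun t : ℝ => |t| ^ (q - 2)) (Z x)).trace)
      (by fun_prop) (by fun_prop) (by fun_prop) (by fun_prop) ?_
    · rw [(hν k).integral_sq, one_mul, ← integral_add] at h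
      · refine h.trans ?_
        refine integral_mono_ae (integrable_pi_of_continuous hν (by fun_prop))
          (integrable_pi_of_continuous hν (by fun_prop)) ?_
        filter_upwards [ae_pi_abs_le hν] with x hx
        have n1 : 0 ≤ (H k x * H k x * (H k x * H k x) *
            cfc (fun t : ℝ => |t| ^ (q - 2)) (Z x)).trace :=
          trace_mul_cfc_nonneg (hH k x).posSemidef_mul_self.1.posSemidef_mul_self (hZ x).1 _
            fun _ => Real.rpow_nonneg (abs_nonneg _) _
        have hxk : x k ^ 2 ≤ L ^ 2 :=
          sq_le_sq' (by linarith [neg_abs_le (x k), hx k]) (le_trans (le_abs_self _) (hx k))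
        have n2 : x k ^ 4 + ∫ s, s ^ 4 ∂(ν k) ≤ (x k ^ 2 + 1) * L ^ 2 := by
          nlinarith [(hν k).integral_pow_four_le, mul_le_mul_of_nonneg_left hxk (sq_nonneg (x k))]
        have n3 := mul_le_mul_of_nonneg_right n2 (mul_nonneg (by linarith : 0 ≤ q - 1) n1)
        have n4 := mul_trace_mul_self_mul_cfc_le (q := q) (by linarith) hκ (hH k x) (hZ x)
        have n5 := mul_le_mul_of_nonneg_left n4 (by positivity : 0 ≤ x k ^ 2 + 1)
        have n6 := mul_le_mul_of_nonneg_right (add_le_add_left hxk 1)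
          (mul_nonneg (Real.rpow_nonneg (by linarith : 0 ≤ 4 * κ) (q - 1))
            (tracePow_nonneg (2 * q) (hH k x)))
        simp only [hKdef, hκdef] at *
        linarith
      all_goals exact integrable_pi_of_continuous hν (by fun_prop)
    · intro x s
      have hZu : Z x - Z (Function.update x k s) = (x k ^ 2 - s ^ 2) • (H k x * H k x) := by
        simp only [hZdef, hI k hk]
        exact sum_smul_update I hk (fun s => s ^ 2) x s
      have h := trace_sub_mul_cfc_mul_abs_rpow_sub_le (r := q - 2) (by linarith) (hZ x).1
        (hZ (Function.update x k s)).1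
      rw [hZu] at h
      simp only [hI k hk]
      simp only [Matrix.smul_mul, Matrix.mul_smul, mul_sub, mul_add, Matrix.trace_smul,
        Matrix.trace_sub, Matrix.trace_add, smul_eq_mul] at h ⊢
      have n1 := trace_mul_cfc_nonneg (hH k x).posSemidef_mul_self.1.posSemidef_mul_self (hZ x).1
        (fun t => |t| ^ (q - 2)) fun _ => Real.rpow_nonneg (abs_nonneg _) _
      have n2 := trace_mul_cfc_nonneg (hH k x).posSemidef_mul_self.1.posSemidef_mul_self
        (hZ (Function.update x k s)).1
        (fun t => |t| ^ (q - 2)) fun _ => Real.rpow_nonneg (abs_nonneg _) _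
      have n3 : (x k ^ 2 - s ^ 2) ^ 2 ≤ x k ^ 4 + s ^ 4 := by
        nlinarith [mul_nonneg (sq_nonneg (x k)) (sq_nonneg s)]
      have n4 := mul_le_mul_of_nonneg_right n3
        (mul_nonneg (by linarith : 0 ≤ q - 1) (add_nonneg n1 n2))
      linarith
  have hrep : ∀ x, tracePow q (Z x) = ∑ k ∈ I,
      x k ^ 2 * (H k x * H k x * cfc (fun t : ℝ => t * |t| ^ (q - 2)) (Z x)).trace := by
    intro x
    rw [tracePow_eq_trace_mul (by linarith) (hZ x).1]
    nth_rewrite 1 [hZdef]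
    simp only [Finset.sum_mul, Matrix.trace_sum, Matrix.smul_mul, Matrix.trace_smul, smul_eq_mul]
  have main : ∫ x, tracePow q (Z x) ∂(Measure.pi ν) ≤
      ∫ x, (1 / 2 * tracePow q (Z x) + 5 ^ q * tracePow q (E x) +
        K * ∑ k ∈ I, tracePow (2 * q) (H k x)) ∂(Measure.pi ν) := by
    calc _ = ∑ k ∈ I, ∫ x, x k ^ 2 * (H k x * H k x *
          cfc (fun t : ℝ => t * |t| ^ (q - 2)) (Z x)).trace ∂(Measure.pi ν) := by
          simp only [hrep]
          exact integral_finsetSum _ fun k _ => integrable_pi_of_continuous hν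
            (by have := hc k; fun_prop)
      _ ≤ _ := Finset.sum_le_sum step
      _ = ∫ x, ∑ k ∈ I,
          (5 / 4 * (H k x * H k x * cfc (fun t : ℝ => t * |t| ^ (q - 2)) (Z x)).trace +
          1 / 4 * (x k ^ 2 * (H k x * H k x * cfc (fun t : ℝ => t * |t| ^ (q - 2)) (Z x)).trace) +
          K * tracePow (2 * q) (H k x)) ∂(Measure.pi ν) :=
          (integral_finsetSum _ fun k _ => integrable_pi_of_continuous hν
            (by have := hc k; have := cTH k; fun_prop)).symm
      _ ≤ _ := by
          refine integral_mono (integrable_pi_of_continuous hν ?_)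
            (integrable_pi_of_continuous hν (by fun_prop)) fun x => ?_
          · refine continuous_finsetSum _ fun k _ => ?_
            have := hc k
            have := cTH k
            fun_prop
          have e : ∑ k ∈ I,
              (5 / 4 * (H k x * H k x * cfc (fun t : ℝ => t * |t| ^ (q - 2)) (Z x)).trace +
              1 / 4 * (x k ^ 2 * (H k x * H k x *
                cfc (fun t : ℝ => t * |t| ^ (q - 2)) (Z x)).trace) +
              K * tracePow (2 * q) (H k x)) =
              5 / 4 * (E x * cfc (fun t : ℝ => t * |t| ^ (q - 2)) (Z x)).trace +
              1 / 4 * tracePow q (Z x) + K * ∑ k ∈ I, tracePow (2 * q) (H k x) := by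
            rw [hrep, Finset.sum_add_distrib, Finset.sum_add_distrib, ← Finset.mul_sum,
              ← Finset.mul_sum, ← Finset.mul_sum]
            simp only [hEdef, Finset.sum_mul, Matrix.trace_sum]
          dsimp only
          rw [e]
          -- Young's inequality with κ = 5/4 produces 5^q and the second quarter to be absorbed.
          have h1 := mul_trace_mul_cfc_mul_abs_rpow_le (q := q) (κ := 5 / 4) (by linarith)
            (by norm_num) (hE x) (hZ x)
          norm_num at h1 ⊢
          linarith
  have cS : Continuous fun x => ∑ k ∈ I, tracePow (2 * q) (H k x) :=
    continuous_finsetSum _ fun k _ => cTH k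
  rw [integral_add, integral_add, integral_const_mul, integral_const_mul, integral_const_mul,
    integral_finsetSum _ fun k _ => integrable_pi_of_continuous hν (cTH k)] at main
  · have h0 : 0 ≤ ∑ k ∈ I, ∫ x, tracePow (2 * q) (H k x) ∂(Measure.pi ν) :=
      Finset.sum_nonneg fun k _ => integral_nonneg fun x => tracePow_nonneg _ (hH k x)
    have := mul_le_mul_of_nonneg_right hK h0
    linarith
  all_goals exact integrable_pi_of_continuous hν (by fun_prop)

end Rosenthal

/-! ### Trace powers are determined by power sums -/

section PowerSums

/-- Zero is added to the interpolation nodes to remove the constant term. Zero eigenvalues then go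
unnoticed, so matrices of different sizes can be compared through traces of positive powers. -/
theorem exists_polynomial_eval_eq {S : Set ℝ} (hS : S.Finite) {f : ℝ → ℝ} (hf : f 0 = 0) :
    ∃ P : Polynomial ℝ, P.coeff 0 = 0 ∧ ∀ x ∈ S, P.eval x = f x := by
  classical
  have h : ∀ x ∈ insert 0 hS.toFinset,
      (Lagrange.interpolate (insert 0 hS.toFinset) id f).eval x = f x := fun x hx =>
    Lagrange.eval_interpolate_at_node (v := id) f (Function.injective_id.injOn) hx
  refine ⟨Lagrange.interpolate (insert 0 hS.toFinset) id f, ?_, fun x hx => h x (by simp [hx])⟩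
  rw [Polynomial.coeff_zero_eq_eval_zero, h 0 (by simp), hf]

theorem tracePow_eq_sum_coeff {N : Type*} [Fintype N] [DecidableEq N] {A : Matrix N N ℝ}
    (hA : A.IsHermitian) {s : ℝ} {P : Polynomial ℝ}
    (hP : ∀ x ∈ spectrum ℝ A, P.eval x = |x| ^ s) :
    tracePow s A = ∑ k ∈ P.support, P.coeff k * (A ^ k).trace := by
  have h : cfc (fun x : ℝ => |x| ^ s) A = Polynomial.aeval A P := by
    rw [← cfc_polynomial P A hA.isSelfAdjoint]
    exact cfc_congr fun x hx => (hP x hx).symm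
  rw [tracePow, h, Polynomial.aeval_eq_sum_range, Matrix.trace_sum,
    ← Finset.sum_subset Polynomial.supp_subset_range_natDegree_succ]
  · exact Finset.sum_congr rfl fun k _ => by rw [Matrix.trace_smul, smul_eq_mul]
  · intro k _ hk
    rw [Polynomial.notMem_support_iff.1 hk, zero_smul, Matrix.trace_zero]

/-- Symmetric matrices with the same power sums have the same trace powers. -/
theorem tracePow_eq_of_trace_pow_eq {N N₁ : Type*} [Fintype N] [DecidableEq N] [Fintype N₁]
    [DecidableEq N₁] {s : ℝ} (hs : 0 < s) {A : Matrix N N ℝ} (hA : A.IsHermitian)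
    {B : Matrix N₁ N₁ ℝ} (hB : B.IsHermitian)
    (h : ∀ k, (A ^ (k + 1)).trace = (B ^ (k + 1)).trace) : tracePow s A = tracePow s B := by
  obtain ⟨P, h0, hP⟩ := exists_polynomial_eval_eq ((Matrix.finite_real_spectrum (A := A)).union
    (Matrix.finite_real_spectrum (A := B))) (f := fun x => |x| ^ s) (by simp [hs.ne'])
  rw [tracePow_eq_sum_coeff hA fun x hx => hP x (Or.inl hx),
    tracePow_eq_sum_coeff hB fun x hx => hP x (Or.inr hx)]
  refine Finset.sum_congr rfl fun k _ => ?_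
  rcases k with _ | k
  · simp [h0]
  · rw [h]

theorem tracePow_fromBlocks {N N₁ : Type*} [Fintype N] [DecidableEq N] [Fintype N₁]
    [DecidableEq N₁] {s : ℝ} (hs : 0 < s) {A : Matrix N N ℝ} (hA : A.IsHermitian)
    {B : Matrix N₁ N₁ ℝ} (hB : B.IsHermitian) :
    tracePow s (Matrix.fromBlocks A 0 0 B) = tracePow s A + tracePow s B := by
  have hC : (Matrix.fromBlocks A 0 0 B).IsHermitian := hA.fromBlocks (by simp) hB
  obtain ⟨P, h0, hP⟩ := exists_polynomial_eval_eq (((Matrix.finite_real_spectrum (A := A)).union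
    (Matrix.finite_real_spectrum (A := B))).union (Matrix.finite_real_spectrum
      (A := Matrix.fromBlocks A 0 0 B))) (f := fun x => |x| ^ s) (by simp [hs.ne'])
  rw [tracePow_eq_sum_coeff hA fun x hx => hP x (Or.inl (Or.inl hx)),
    tracePow_eq_sum_coeff hB fun x hx => hP x (Or.inl (Or.inr hx)),
    tracePow_eq_sum_coeff hC fun x hx => hP x (Or.inr hx), ← Finset.sum_add_distrib]
  refine Finset.sum_congr rfl fun k _ => ?_
  rw [Matrix.fromBlocks_diagonal_pow, ← mul_add]
  simp [Matrix.trace, Fintype.sum_sum_type]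

theorem tracePow_blockDiagonal {N o : Type*} [Fintype N] [DecidableEq N] [Fintype o]
    [DecidableEq o] {s : ℝ} (hs : 0 < s) {A : o → Matrix N N ℝ} (hA : ∀ i, (A i).IsHermitian) :
    tracePow s (Matrix.blockDiagonal A) = ∑ i, tracePow s (A i) := by
  have hC : (Matrix.blockDiagonal A).IsHermitian := by
    rw [Matrix.IsHermitian, Matrix.blockDiagonal_conjTranspose]
    simp only [fun i => (hA i).eq]
  obtain ⟨P, h0, hP⟩ := exists_polynomial_eval_eq ((Set.finite_iUnion fun i =>
    Matrix.finite_real_spectrum (A := A i)).union (Matrix.finite_real_spectrum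
      (A := Matrix.blockDiagonal A))) (f := fun x => |x| ^ s) (by simp [hs.ne'])
  rw [tracePow_eq_sum_coeff hC fun x hx => hP x (Or.inr hx)]
  simp only [fun i => tracePow_eq_sum_coeff (hA i) fun x hx =>
    hP x (Or.inl (Set.mem_iUnion.2 ⟨i, hx⟩))]
  rw [Finset.sum_comm]
  refine Finset.sum_congr rfl fun k _ => ?_
  rw [← Matrix.blockDiagonal_pow, Matrix.trace_blockDiagonal, Finset.mul_sum]
  rfl

theorem tracePow_two_mul {N : Type*} [Fintype N] [DecidableEq N] (q : ℝ) {A : Matrix N N ℝ}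
    (hA : A.IsHermitian) : tracePow (2 * q) A = tracePow q (A * A) := by
  rw [tracePow, tracePow, ← sq, ← cfc_comp_pow (fun x : ℝ => |x| ^ q) 2 A
    (((Matrix.finite_real_spectrum (A := A)).image _).continuousOn _) hA.isSelfAdjoint]
  congr 2
  ext x
  rw [Real.rpow_mul (abs_nonneg x), abs_pow]
  norm_cast

theorem tracePow_smul {N : Type*} [Fintype N] [DecidableEq N] (s : ℝ) (c : ℝ) {A : Matrix N N ℝ}
    (hA : A.IsHermitian) : tracePow s (c • A) = |c| ^ s * tracePow s A := by
  rw [tracePow, tracePow, ← cfc_comp_const_mul c (fun x : ℝ => |x| ^ s) A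
    (((Matrix.finite_real_spectrum (A := A)).image _).continuousOn _) hA.isSelfAdjoint,
    ← smul_eq_mul, ← Matrix.trace_smul, ← cfc_const_mul _ _ _ (continuousOn_spectrum_of_matrix _ _)]
  congr 2
  ext x
  rw [abs_mul, Real.mul_rpow (abs_nonneg _) (abs_nonneg _)]

end PowerSums

/-! ### Schatten norms and symmetric dilations -/

section Schatten

theorem isHermitian_transpose_mul_self_real {m q : Type*} [Fintype m] (M : Matrix m q ℝ) :
    (M.transpose * M).IsHermitian := by
  rw [← Matrix.conjTranspose_eq_transpose_of_trivial]
  exact Matrix.isHermitian_conjTranspose_mul_self M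

theorem isHermitian_mul_transpose_self_real {m q : Type*} [Fintype q] (M : Matrix m q ℝ) :
    (M * M.transpose).IsHermitian := by
  rw [← Matrix.conjTranspose_eq_transpose_of_trivial]
  exact Matrix.isHermitian_mul_conjTranspose_self M

/-- The symmetric dilation of a matrix. -/
def dilation {m q : Type*} (M : Matrix m q ℝ) : Matrix (m ⊕ q) (m ⊕ q) ℝ :=
  Matrix.fromBlocks 0 M M.transpose 0

theorem isHermitian_dilation {m q : Type*} (M : Matrix m q ℝ) : (dilation M).IsHermitian := by
  rw [Matrix.IsHermitian, dilation, Matrix.fromBlocks_conjTranspose]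
  simp [Matrix.conjTranspose_eq_transpose_of_trivial]

theorem dilation_mul_self {m q : Type*} [Fintype m] [Fintype q] (M : Matrix m q ℝ) :
    dilation M * dilation M =
    Matrix.fromBlocks (M * M.transpose) 0 0 (M.transpose * M) := by
  rw [dilation, Matrix.fromBlocks_multiply]
  simp

theorem dilation_sum_smul {ι m q : Type*} (I : Finset ι) (c : ι → ℝ) (M : ι → Matrix m q ℝ) :
    dilation (∑ k ∈ I, c k • M k) = ∑ k ∈ I, c k • dilation (M k) := by
  ext (i | i) (j | j) <;> simp [dilation, Matrix.sum_apply]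

variable {m q : Type*} [Fintype m] [Fintype q] [DecidableEq q]

/-- The `2 r`-th power of the Schatten `2 r`-norm. -/
noncomputable def schattenPow (r : ℝ) (M : Matrix m q ℝ) : ℝ := tracePow r (M.transpose * M)

theorem schattenPow_nonneg (r : ℝ) (M : Matrix m q ℝ) : 0 ≤ schattenPow r M :=
  tracePow_nonneg r (isHermitian_transpose_mul_self_real M)

theorem schattenNorm_rpow_eq {p : ℝ} (hp : 0 < p) (M : Matrix m q ℝ) :
    schattenNorm p M ^ p = schattenPow (p / 2) M := by
  have hps : (M.transpose * M).PosSemidef := by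
    rw [← Matrix.conjTranspose_eq_transpose_of_trivial]
    exact Matrix.posSemidef_conjTranspose_mul_self M
  have h : (cfc (fun s : ℝ => s ^ (p / 2)) (M.transpose * M)).trace = schattenPow (p / 2) M := by
    rw [schattenPow, tracePow, trace_cfc_eq_sum hps.1, trace_cfc_eq_sum hps.1]
    exact Finset.sum_congr rfl fun j _ => by rw [abs_of_nonneg (hps.eigenvalues_nonneg j)]
  rw [schattenNorm, h, ← Real.rpow_mul (schattenPow_nonneg _ M), one_div_mul_cancel hp.ne',
    Real.rpow_one]

theorem continuous_schattenPow_comp {X : Type*} [TopologicalSpace X] {r : ℝ} (hr : 0 ≤ r)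
    {M : X → Matrix m q ℝ} (hM : Continuous M) : Continuous fun x => schattenPow r (M x) :=
  continuous_tracePow_comp hr (hM.matrix_transpose.matrix_mul hM)
    fun _ => isHermitian_transpose_mul_self_real _

theorem schattenPow_smul (r c : ℝ) (M : Matrix m q ℝ) :
    schattenPow r (c • M) = |c| ^ (2 * r) * schattenPow r M := by
  rw [schattenPow, schattenPow, Matrix.transpose_smul, Matrix.smul_mul, Matrix.mul_smul, smul_smul,
    tracePow_smul _ _ (isHermitian_transpose_mul_self_real M), abs_mul_self, ← abs_mul_abs_self,
    ← sq, Real.rpow_mul (abs_nonneg c)]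
  norm_cast

theorem schattenPow_zero {r : ℝ} (hr : 0 < r) : schattenPow r (0 : Matrix m q ℝ) = 0 := by
  have := schattenPow_smul r 0 (0 : Matrix m q ℝ)
  rwa [zero_smul, abs_zero, Real.zero_rpow (by linarith), zero_mul] at this

theorem transpose_mul_self_pow_mul_transpose [DecidableEq m] (M : Matrix m q ℝ) (k : ℕ) :
    (M.transpose * M) ^ k * M.transpose = M.transpose * (M * M.transpose) ^ k := by
  induction k with
  | zero => simp
  | succ k ih => rw [pow_succ', Matrix.mul_assoc, ih, pow_succ']; simp only [Matrix.mul_assoc]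

/-- By cyclicity of the trace the two Gram matrices have the same power sums. -/
theorem schattenPow_eq_tracePow_mul_transpose [DecidableEq m] {r : ℝ} (hr : 0 < r)
    (M : Matrix m q ℝ) : schattenPow r M = tracePow r (M * M.transpose) := by
  refine tracePow_eq_of_trace_pow_eq hr (isHermitian_transpose_mul_self_real M)
    (isHermitian_mul_transpose_self_real M) fun k => ?_
  rw [pow_succ, ← Matrix.mul_assoc, transpose_mul_self_pow_mul_transpose, Matrix.mul_assoc,
    Matrix.trace_mul_comm, Matrix.mul_assoc, ← pow_succ]

theorem schattenPow_submatrix {m' q' : Type*} [Fintype m'] [Fintype q'] [DecidableEq q'] {r : ℝ}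
    (hr : 0 < r) (M : Matrix m q ℝ) (e : m' ≃ m) (f : q' ≃ q) :
    schattenPow r (M.submatrix e f) = schattenPow r M := by
  refine tracePow_eq_of_trace_pow_eq hr (isHermitian_transpose_mul_self_real _)
    (isHermitian_transpose_mul_self_real _) fun k => ?_
  have h : (M.submatrix e f).transpose * M.submatrix e f =
      Matrix.reindexAlgEquiv ℝ ℝ f.symm (M.transpose * M) := by
    rw [Matrix.transpose_submatrix, Matrix.submatrix_mul_equiv]
    rfl
  rw [h, ← map_pow]
  exact Equiv.sum_comp f (fun i => ((M.transpose * M) ^ (k + 1)) i i)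

/-- The square of the dilation is block diagonal with the two Gram matrices as blocks, each
contributing equally. -/
theorem tracePow_dilation [DecidableEq m] {r : ℝ} (hr : 0 < r) (M : Matrix m q ℝ) :
    tracePow (2 * r) (dilation M) = 2 * schattenPow r M := by
  rw [tracePow_two_mul _ (isHermitian_dilation M), dilation_mul_self, tracePow_fromBlocks hr
    (isHermitian_mul_transpose_self_real M) (isHermitian_transpose_mul_self_real M),
    ← schattenPow_eq_tracePow_mul_transpose hr, schattenPow, two_mul]

/-- Jensen's inequality for the power of the Schatten norm. -/
theorem schattenPow_average_le {ι : Type*} {r : ℝ} (hr : 1 < r) (J : Finset ι) (hJ : J.Nonempty)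
    (M : ι → Matrix m q ℝ) :
    schattenPow r (((J.card : ℝ)⁻¹) • ∑ j ∈ J, M j) ≤ (J.card : ℝ)⁻¹ * ∑ j ∈ J, schattenPow r (M j) := by
  classical
  have hJ0 : (J.card : ℝ) ≠ 0 := by simpa using hJ.ne_empty
  have hr0 : 0 < r := by linarith
  set B := dilation (((J.card : ℝ)⁻¹) • ∑ j ∈ J, M j) with hB
  have hBs : (J.card : ℝ) • B = ∑ j ∈ J, dilation (M j) := by
    have h1 := dilation_sum_smul J (fun _ => (J.card : ℝ)⁻¹) M
    rw [← Finset.smul_sum, ← Finset.smul_sum] at h1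
    rw [hB, h1, smul_smul, mul_inv_cancel₀ hJ0, one_smul]
  -- The tangent inequalities at the mean are summed over j; the linear terms cancel because the
  -- dilations sum to a multiple of B.
  have h := Finset.sum_le_sum fun j (_ : j ∈ J) => tracePow_tangent_le (s := 2 * r) (by linarith)
    (isHermitian_dilation (M j)) (isHermitian_dilation (((J.card : ℝ)⁻¹) • ∑ j ∈ J, M j))
  rw [← hB, Finset.sum_add_distrib, ← Matrix.trace_sum, ← Finset.sum_mul, Finset.sum_sub_distrib,
    ← hBs, Finset.sum_const, Finset.sum_const, ← Nat.cast_smul_eq_nsmul ℝ,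
    ← Nat.cast_smul_eq_nsmul ℝ, sub_self, zero_mul,
    Matrix.trace_zero, add_zero, hB, tracePow_dilation hr0] at h
  simp only [tracePow_dilation hr0, ← Finset.mul_sum] at h
  rw [smul_eq_mul] at h
  rw [inv_mul_eq_div, le_div_iff₀ (by positivity)]
  linarith

end Schatten

/-! ### Schatten norms of stacked and diagonal block matrices -/

section Blocks

variable {ι m q R : Type*}

/-- Matrices stacked vertically. -/
def vertBlock (M : ι → Matrix m q R) : Matrix (ι × m) q R := Matrix.of fun i s => M i.1 i.2 s

/-- Matrices stacked horizontally. -/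
def horizBlock (M : ι → Matrix m q R) : Matrix m (ι × q) R := Matrix.of fun r j => M j.1 r j.2

/-- Matrices placed along the diagonal. -/
def diagBlock [DecidableEq ι] [Zero R] (M : ι → Matrix m q R) : Matrix (ι × m) (ι × q) R :=
  Matrix.of fun i j => if i.1 = j.1 then M i.1 i.2 j.2 else 0

theorem schattenPow_vertBlock [Fintype ι] [Fintype m] [Fintype q] [DecidableEq q] (r : ℝ)
    (M : ι → Matrix m q ℝ) :
    schattenPow r (vertBlock M) = tracePow r (∑ k, (M k).transpose * M k) := by
  rw [schattenPow]
  congr 1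
  ext i j
  simp [vertBlock, Matrix.mul_apply, Matrix.sum_apply, Fintype.sum_prod_type]

theorem schattenPow_horizBlock [Fintype ι] [DecidableEq ι] [Fintype m] [DecidableEq m] [Fintype q]
    [DecidableEq q] {r : ℝ} (hr : 0 < r) (M : ι → Matrix m q ℝ) :
    schattenPow r (horizBlock M) = tracePow r (∑ k, M k * (M k).transpose) := by
  rw [schattenPow_eq_tracePow_mul_transpose hr]
  congr 1
  ext i j
  simp [horizBlock, Matrix.mul_apply, Matrix.sum_apply, Fintype.sum_prod_type]

theorem schattenPow_diagBlock [Fintype ι] [DecidableEq ι] [Fintype m] [Fintype q]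
    [DecidableEq q] {r : ℝ} (hr : 0 < r) (M : ι → Matrix m q ℝ) :
    schattenPow r (diagBlock M) = ∑ k, schattenPow r (M k) := by
  have h : diagBlock M = (Matrix.blockDiagonal M).submatrix (Equiv.prodComm ι m)
      (Equiv.prodComm ι q) := rfl
  rw [h, schattenPow_submatrix hr, schattenPow, Matrix.blockDiagonal_transpose,
    ← Matrix.blockDiagonal_mul, tracePow_blockDiagonal hr
      fun k => isHermitian_transpose_mul_self_real (M k)]
  rfl

end Blocks

/-! ### The Rosenthal inequality for rectangular matrices -/

section Rosenthal

theorem mul_rpow_le_rpow {a b c q : ℝ} (hq : 1 ≤ q) (ha : 0 ≤ a) (hc : 1 ≤ c) (hb : c * a ≤ b) :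
    c * a ^ q ≤ b ^ q := by
  have hc0 : 0 ≤ c := by linarith
  calc c * a ^ q ≤ c ^ q * a ^ q := by
        refine mul_le_mul_of_nonneg_right ?_ (Real.rpow_nonneg ha _)
        simpa using Real.rpow_le_rpow_of_exponent_le hc hq
    _ = (c * a) ^ q := (Real.mul_rpow hc0 ha).symm
    _ ≤ b ^ q := Real.rpow_le_rpow (mul_nonneg hc0 ha) hb (by linarith)

/-- The matrix Rosenthal inequality for sums with coefficients that may depend on the other
variables. -/
theorem integral_schattenPow_sum_le {ι : Type*} [Fintype ι] [DecidableEq ι] [Nonempty ι]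
    {L : ℝ} {ν : ι → Measure ℝ} (hν : ∀ i, IsStandardBounded L (ν i))
    {m q : Type*} [Fintype m] [Fintype q] [DecidableEq q] (I : Finset ι)
    {M : ι → (ι → ℝ) → Matrix m q ℝ} (hc : ∀ k, Continuous (M k))
    (hI : ∀ j ∈ I, ∀ k x s, M k (Function.update x j s) = M k x) {r : ℝ} (hr : 4 ≤ r) :
    3 * ∫ x, schattenPow r (∑ k ∈ I, x k • M k x) ∂(Measure.pi ν) ≤ (24 * r) ^ (2 * r) *
      (∫ x, schattenPow r (vertBlock fun k => M k x) ∂(Measure.pi ν) +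
        ∫ x, schattenPow r (horizBlock fun k => M k x) ∂(Measure.pi ν) +
        L ^ (2 * r) * ∫ x, schattenPow r (diagBlock fun k => M k x) ∂(Measure.pi ν)) := by
  classical
  have hr0 : 0 < r := by linarith
  have hL : 1 ≤ L := (hν (Classical.arbitrary ι)).one_le
  set v := ∫ x, schattenPow r (vertBlock fun k => M k x) ∂(Measure.pi ν) with hv
  set h := ∫ x, schattenPow r (horizBlock fun k => M k x) ∂(Measure.pi ν) with hh
  set d := ∫ x, schattenPow r (diagBlock fun k => M k x) ∂(Measure.pi ν) with hd
  have hv0 : 0 ≤ v := integral_nonneg fun x => schattenPow_nonneg _ _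
  have hh0 : 0 ≤ h := integral_nonneg fun x => schattenPow_nonneg _ _
  have hd0 : 0 ≤ d := integral_nonneg fun x => schattenPow_nonneg _ _
  have cdil : ∀ k, Continuous fun x => dilation (M k x) := fun k => by
    have := hc k
    unfold dilation
    fun_prop
  have cv : Continuous fun x => schattenPow r (vertBlock fun k => M k x) :=
    continuous_schattenPow_comp hr0.le <| continuous_matrix fun i j =>
      (hc i.1).matrix_elem i.2 j
  have ch : Continuous fun x => schattenPow r (horizBlock fun k => M k x) :=
    continuous_schattenPow_comp hr0.le <| continuous_matrix fun i j =>
      (hc j.1).matrix_elem i j.2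
  have h1 := integral_tracePow_sum_le hν I (H := fun k x => dilation (M k x))
    (fun k x => isHermitian_dilation _) cdil (fun j hj k x s => by rw [hI j hj]) hr
  have h2 := integral_tracePow_sum_sq_le hν I (H := fun k x => dilation (M k x))
    (fun k x => isHermitian_dilation _) cdil (fun j hj k x s => by rw [hI j hj]) hr
  simp only [← dilation_sum_smul, tracePow_dilation hr0, integral_const_mul,
    ← Finset.mul_sum] at h1 h2
  -- The summed squares of the dilations split into the Gram matrices of the horizontal and vertical
  -- stacks. Enlarging I to all indices is harmless by monotonicity.
  have hE : ∫ x, tracePow r (∑ k ∈ I, dilation (M k x) * dilation (M k x)) ∂(Measure.pi ν) ≤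
      v + h := by
    rw [hv, hh, ← integral_add (integrable_pi_of_continuous hν cv)
      (integrable_pi_of_continuous hν ch)]
    refine integral_mono (integrable_pi_of_continuous hν ?_)
      (integrable_pi_of_continuous hν (cv.add ch)) fun x => ?_
    · refine continuous_tracePow_comp hr0.le (by fun_prop) fun x => ?_
      exact isHermitian_sum fun k => (isHermitian_dilation _).posSemidef_mul_self.1
    · have hps : ∀ J : Finset ι, (∑ k ∈ J, dilation (M k x) * dilation (M k x)).PosSemidef :=
        fun J => Matrix.posSemidef_sum _ fun k _ => (isHermitian_dilation _).posSemidef_mul_self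
      have h3 : tracePow r (∑ k ∈ I, dilation (M k x) * dilation (M k x)) ≤
          tracePow r (∑ k, dilation (M k x) * dilation (M k x)) := by
        refine tracePow_le_of_posSemidef_sub (by linarith) (hps I) ?_
        rw [← Finset.sum_sdiff (Finset.subset_univ I), add_sub_cancel_right]
        exact hps _
      refine h3.trans (le_of_eq ?_)
      have h4 : ∑ k, dilation (M k x) * dilation (M k x) =
          Matrix.fromBlocks (∑ k, M k x * (M k x).transpose) 0 0
            (∑ k, (M k x).transpose * M k x) := by
        simp only [dilation_mul_self]
        ext (i | i) (j | j) <;> simp [Matrix.sum_apply]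
      rw [h4, tracePow_fromBlocks hr0
        (isHermitian_sum fun k => isHermitian_mul_transpose_self_real _)
        (isHermitian_sum fun k => isHermitian_transpose_mul_self_real _)]
      rw [schattenPow_vertBlock, schattenPow_horizBlock hr0, add_comm]
  have hD : ∑ k ∈ I, ∫ x, schattenPow r (M k x) ∂(Measure.pi ν) ≤ d := by
    simp only [hd, schattenPow_diagBlock hr0]
    rw [integral_finsetSum _ fun k _ =>
      integrable_pi_of_continuous hν (continuous_schattenPow_comp hr0.le (hc k))]
    exact Finset.sum_le_univ_sum_of_nonneg fun k => integral_nonneg fun x => schattenPow_nonneg _ _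
  have hC : (24 * r) ^ (2 * r) = (576 * r ^ 2) ^ r := by
    rw [Real.rpow_mul (by positivity)]
    congr 1
    norm_cast
    ring
  have hL2 : (4 * r * L ^ 2) ^ r = (4 * r) ^ r * L ^ (2 * r) := by
    rw [Real.mul_rpow (by positivity) (by positivity), Real.rpow_mul (by positivity)]
    norm_cast
  rw [hL2] at h2
  rw [hC]
  have hLp : 0 ≤ L ^ (2 * r) := Real.rpow_nonneg (by linarith) _
  -- Here 9 = 3 · 3, from the 3 in the claim and 1 + 2 · 5^r ≤ 3 · 5^r; below, 6 = 3 · 2 with 2 from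
  -- the dilation. The bases compare since 720 r ≤ 576 r² and 384 r² ≤ 576 r².
  have k1 : 9 * (80 * r) ^ r ≤ (576 * r ^ 2) ^ r :=
    mul_rpow_le_rpow (by linarith) (by positivity) (by norm_num) (by nlinarith)
  have k2 : 6 * (64 * r ^ 2) ^ r ≤ (576 * r ^ 2) ^ r :=
    mul_rpow_le_rpow (by linarith) (by positivity) (by norm_num) (by nlinarith)
  have e1 : (80 * r) ^ r = (16 * r) ^ r * 5 ^ r := by
    rw [← Real.mul_rpow (by positivity) (by positivity)]; congr 1; ring
  have e2 : (64 * r ^ 2) ^ r = (16 * r) ^ r * (4 * r) ^ r := by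
    rw [← Real.mul_rpow (by positivity) (by positivity)]; congr 1; ring
  have e3 : (1 : ℝ) ≤ 5 ^ r := Real.one_le_rpow (by norm_num) hr0.le
  have p16 : 0 ≤ (16 * r) ^ r := Real.rpow_nonneg (by linarith) _
  have p4 : 0 ≤ (4 * r) ^ r := Real.rpow_nonneg (by linarith) _
  set e := ∫ x, tracePow r (∑ k ∈ I, dilation (M k x) * dilation (M k x)) ∂(Measure.pi ν)
  set S := ∫ x, schattenPow r (∑ k ∈ I, x k • M k x) ∂(Measure.pi ν)
  set D := ∑ k ∈ I, ∫ x, schattenPow r (M k x) ∂(Measure.pi ν)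
  have f1 : S ≤ (16 * r) ^ r * ((1 + 2 * 5 ^ r) * e + (4 * r) ^ r * L ^ (2 * r) * (2 * D)) := by
    have := mul_le_mul_of_nonneg_left h2 p16
    linarith
  have f2 : (1 + 2 * 5 ^ r) * e ≤ 3 * 5 ^ r * (v + h) :=
    (mul_le_mul_of_nonneg_left hE (by positivity)).trans
      (mul_le_mul_of_nonneg_right (by linarith) (by positivity))
  have f3 : (4 * r) ^ r * L ^ (2 * r) * (2 * D) ≤ (4 * r) ^ r * L ^ (2 * r) * (2 * d) :=
    mul_le_mul_of_nonneg_left (by linarith) (by positivity)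
  have f4 := mul_le_mul_of_nonneg_left (add_le_add f2 f3) p16
  have f5 := mul_le_mul_of_nonneg_right k1 (add_nonneg hv0 hh0)
  have f6 := mul_le_mul_of_nonneg_right k2 (mul_nonneg hLp hd0)
  rw [e1] at f5
  rw [e2] at f6
  linarith

end Rosenthal

/-! ### Words of steps and iteration over colour classes -/

section StepBlocks

variable {n : ℕ} {m q R : Type*}

/-- The block matrix assembled by the steps of a list from matrices indexed by lists of indices,
one index for each step. -/
def stepBlock [Zero R] : (w : List Step) → (List (Fin n) → Matrix m q R) →
    Matrix (RowIdx n m w) (ColIdx n q w) R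
  | [], B => B []
  | .vert :: w, B => vertBlock fun k => stepBlock w fun l => B (k :: l)
  | .horiz :: w, B => horizBlock fun k => stepBlock w fun l => B (k :: l)
  | .diag :: w, B => diagBlock fun k => stepBlock w fun l => B (k :: l)

/-- Lets the sum over the next index be pulled out of the block assembly, giving the form to which
the Rosenthal inequality applies. -/
theorem stepBlock_sum_smul {ι : Type*} (I : Finset ι) (c : ι → ℝ) (w : List Step)
    (B : ι → List (Fin n) → Matrix m q ℝ) :
    stepBlock w (fun l => ∑ k ∈ I, c k • B k l) = ∑ k ∈ I, c k • stepBlock w (B k) := by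
  induction w generalizing B with
  | nil => rfl
  | cons s w ih =>
    have hsum : ∀ {α β : Type _} (M : ι → Matrix α β ℝ) (i : α) (j : β),
        (∑ k ∈ I, c k • M k) i j = ∑ k ∈ I, c k * M k i j := fun M i j => by
      simp [Matrix.sum_apply]
    ext i j
    cases s
    · exact ((congr_fun₂ (ih fun k l => B k (i.1 :: l)) i.2 j).trans (hsum _ _ _)).trans
        (hsum (fun k => stepBlock (.vert :: w) (B k)) i j).symm
    · exact ((congr_fun₂ (ih fun k l => B k (j.1 :: l)) i j.2).trans (hsum _ _ _)).trans
        (hsum (fun k => stepBlock (.horiz :: w) (B k)) i j).symm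
    · rw [hsum]
      change (if i.1 = j.1 then _ else 0) = ∑ k ∈ I, c k * (if i.1 = j.1 then _ else 0)
      split_ifs
      · exact (congr_fun₂ (ih fun k l => B k (i.1 :: l)) i.2 j.2).trans (hsum _ _ _)
      · simp

theorem stepBlock_smul (c : ℝ) (w : List Step) (B : List (Fin n) → Matrix m q ℝ) :
    stepBlock w (fun l => c • B l) = c • stepBlock w B := by
  simpa using stepBlock_sum_smul {()} (fun _ => c) w fun _ => B

theorem continuous_stepBlock {X : Type*} [TopologicalSpace X] (w : List Step)
    {B : X → List (Fin n) → Matrix m q ℝ} (hB : ∀ l, Continuous fun x => B x l) :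
    Continuous fun x => stepBlock w (B x) := by
  induction w generalizing B with
  | nil => exact hB []
  | cons s w ih =>
    refine continuous_matrix fun i j => ?_
    cases s
    · exact (ih fun l => hB (i.1 :: l)).matrix_elem i.2 j
    · exact (ih fun l => hB (j.1 :: l)).matrix_elem i j.2
    · change Continuous fun x => if i.1 = j.1 then _ else 0
      split_ifs
      · exact (ih fun l => hB (i.1 :: l)).matrix_elem i.2 j.2
      · exact continuous_const

/-- Invariance under reordering of the indices. -/
def PermInvariant {α : Type*} (B : List (Fin n) → α) : Prop := ∀ l l', l.Perm l' → B l = B l'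

/-- Interchange of the first two factors of a triple product. -/
def prodSwap (α β : Type*) : α × α × β ≃ α × α × β where
  toFun z := (z.2.1, z.1, z.2.2)
  invFun z := (z.2.1, z.1, z.2.2)
  left_inv _ := rfl
  right_inv _ := rfl

/-- It suffices to interchange adjacent steps. This swaps two entries of the index list, harmless by
invariance, and at most swaps two factors of the row or column index. -/
theorem exists_submatrix_stepBlock_eq [Zero R] {w w' : List Step} (hw : w.Perm w') :
    ∃ (e : RowIdx n m w ≃ RowIdx n m w') (f : ColIdx n q w ≃ ColIdx n q w'),
      ∀ B : List (Fin n) → Matrix m q R, PermInvariant B →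
        (stepBlock w' B).submatrix e f = stepBlock w B := by
  induction hw with
  | nil => exact ⟨Equiv.refl _, Equiv.refl _, fun B _ => rfl⟩
  | cons s _ ih =>
    obtain ⟨e, f, h⟩ := ih
    have h' : ∀ B : List (Fin n) → Matrix m q R, PermInvariant B → ∀ k i j,
        stepBlock _ (fun l => B (k :: l)) (e i) (f j) = stepBlock _ (fun l => B (k :: l)) i j :=
      fun B hB k i j => congr_fun₂ (h (fun l => B (k :: l)) fun l l' hl => hB _ _ (hl.cons k)) i j
    cases s
    · refine ⟨(Equiv.refl (Fin n)).prodCongr e, f, fun B hB => ?_⟩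
      ext ⟨k, i⟩ j
      exact h' B hB k i j
    · refine ⟨e, (Equiv.refl (Fin n)).prodCongr f, fun B hB => ?_⟩
      ext i ⟨k, j⟩
      exact h' B hB k i j
    · refine ⟨(Equiv.refl (Fin n)).prodCongr e, (Equiv.refl (Fin n)).prodCongr f, fun B hB => ?_⟩
      ext ⟨k, i⟩ ⟨k', j⟩
      exact if_congr Iff.rfl (h' B hB k i j) rfl
  | swap s t w =>
    have h : ∀ B : List (Fin n) → Matrix m q R, PermInvariant B → ∀ k k',
        (fun l => B (k :: k' :: l)) = fun l => B (k' :: k :: l) :=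
      fun B hB k k' => funext fun l => hB _ _ (List.Perm.swap _ _ _)
    cases s <;> cases t
    · refine ⟨prodSwap _ _, Equiv.refl _, fun B hB => ?_⟩
      ext ⟨k, k', i⟩ j
      exact congr_fun₂ (congr_arg (stepBlock w) (h B hB k' k)) i j
    · refine ⟨Equiv.refl _, Equiv.refl _, fun B hB => ?_⟩
      ext ⟨k, i⟩ ⟨k', j⟩
      exact congr_fun₂ (congr_arg (stepBlock w) (h B hB k k')) i j
    · refine ⟨prodSwap _ _, Equiv.refl _, fun B hB => ?_⟩
      ext ⟨k, k', i⟩ ⟨l, j⟩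
      exact if_congr Iff.rfl (congr_fun₂ (congr_arg (stepBlock w) (h B hB k' k)) i j) rfl
    · refine ⟨Equiv.refl _, Equiv.refl _, fun B hB => ?_⟩
      ext ⟨k, i⟩ ⟨k', j⟩
      exact congr_fun₂ (congr_arg (stepBlock w) (h B hB k' k)) i j
    · refine ⟨Equiv.refl _, prodSwap _ _, fun B hB => ?_⟩
      ext i ⟨k, k', j⟩
      exact congr_fun₂ (congr_arg (stepBlock w) (h B hB k' k)) i j
    · refine ⟨Equiv.refl _, prodSwap _ _, fun B hB => ?_⟩
      ext ⟨k, i⟩ ⟨l, l', j⟩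
      exact if_congr Iff.rfl (congr_fun₂ (congr_arg (stepBlock w) (h B hB l' k)) i j) rfl
    · refine ⟨prodSwap _ _, Equiv.refl _, fun B hB => ?_⟩
      ext ⟨k, k', i⟩ ⟨l, j⟩
      exact if_congr Iff.rfl (congr_fun₂ (congr_arg (stepBlock w) (h B hB k' k)) i j) rfl
    · refine ⟨Equiv.refl _, prodSwap _ _, fun B hB => ?_⟩
      ext ⟨k, i⟩ ⟨l, l', j⟩
      exact if_congr Iff.rfl (congr_fun₂ (congr_arg (stepBlock w) (h B hB k l)) i j) rfl
    · refine ⟨prodSwap _ _, prodSwap _ _, fun B hB => ?_⟩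
      ext ⟨k, k', i⟩ ⟨l, l', j⟩
      have := congr_fun₂ (congr_arg (stepBlock w) (h B hB k' k)) i j
      change (if k' = l' then if k = l then _ else 0 else 0) =
        if k = l then if k' = l' then _ else 0 else 0
      split_ifs
      · exact this
      all_goals rfl
  | trans _ _ ih₁ ih₂ =>
    obtain ⟨e₁, f₁, h₁⟩ := ih₁
    obtain ⟨e₂, f₂, h₂⟩ := ih₂
    refine ⟨e₁.trans e₂, f₁.trans f₂, fun B hB => ?_⟩
    rw [← h₁ B hB, ← h₂ B hB]
    rfl

theorem schattenPow_stepBlock_eq_of_perm [Fintype m] [Fintype q] [DecidableEq q] {r : ℝ}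
    (hr : 0 < r) {w w' : List Step} (hw : w.Perm w') {B : List (Fin n) → Matrix m q ℝ}
    (hB : PermInvariant B) :
    schattenPow r (stepBlock w B) = schattenPow r (stepBlock w' B) := by
  obtain ⟨e, f, h⟩ := exists_submatrix_stepBlock_eq (m := m) (q := q) (R := ℝ) (n := n) hw
  rw [← h B hB, schattenPow_submatrix hr]

/-- Partial evaluation: the indices of colour `d - 1, …, 0` are prepended one by one and summed
over with the weights `x`. -/
noncomputable def colorEval (η : Fin n → ℕ) (x : Fin n → ℝ) :
    ℕ → (List (Fin n) → Matrix m q ℝ) → List (Fin n) → Matrix m q ℝ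
  | 0, B, l => B l
  | d + 1, B, l => ∑ k with η k = d, x k • colorEval η x d B (k :: l)

theorem continuous_colorEval (η : Fin n → ℕ) (d : ℕ) (B : List (Fin n) → Matrix m q ℝ)
    (l : List (Fin n)) : Continuous fun x => colorEval η x d B l := by
  induction d generalizing l with
  | zero => exact continuous_const
  | succ d ih =>
    simp only [colorEval]
    exact continuous_finsetSum _ fun k _ => (continuous_apply k).smul (ih _)

/-- Evaluation through the first d colours reads only variables of those colours. This gives the
independence of coefficients from the next summed variables that the Rosenthal inequality requires.
-/
theorem colorEval_update (η : Fin n → ℕ) (d : ℕ) (B : List (Fin n) → Matrix m q ℝ)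
    (l : List (Fin n)) {j : Fin n} (hj : d ≤ η j) (x : Fin n → ℝ) (s : ℝ) :
    colorEval η (Function.update x j s) d B l = colorEval η x d B l := by
  induction d generalizing l with
  | zero => rfl
  | succ d ih =>
    refine Finset.sum_congr rfl fun k hk => ?_
    have hkj : k ≠ j := by
      rintro rfl
      have := (Finset.mem_filter.1 hk).2
      omega
    rw [Function.update_of_ne hkj, ih _ (by omega)]

/-- Iteration of the matrix Rosenthal inequality over the colour classes. -/
theorem pow_mul_integral_schattenPow_stepBlock_colorEval_le [Fintype m] [Fintype q] [DecidableEq q]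
    [Nonempty (Fin n)] {L : ℝ} {ν : Fin n → Measure ℝ} (hν : ∀ i, IsStandardBounded L (ν i))
    {r : ℝ} (hr : 4 ≤ r) (η : Fin n → ℕ) (B : List (Fin n) → Matrix m q ℝ) {S : ℝ} (d : ℕ)
    (w : List Step)
    (hS : ∀ w', w'.length = d + w.length →
      (L ^ (2 * r)) ^ (w'.count Step.diag) * schattenPow r (stepBlock w' B) ≤ S) :
    (L ^ (2 * r)) ^ (w.count Step.diag) *
      ∫ x, schattenPow r (stepBlock w (colorEval η x d B)) ∂(Measure.pi ν) ≤
        ((24 * r) ^ (2 * r)) ^ d * S := by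
  have hL : 1 ≤ L := (hν (Classical.arbitrary _)).one_le
  have hLp : 0 ≤ L ^ (2 * r) := Real.rpow_nonneg (by linarith) _
  have hK : 0 ≤ (24 * r) ^ (2 * r) := Real.rpow_nonneg (by linarith) _
  induction d generalizing w with
  | zero =>
    have := fun i => (hν i).isProbabilityMeasure
    simpa [colorEval] using hS w (by simp)
  | succ d ih =>
    have hR := integral_schattenPow_sum_le hν (Finset.univ.filter fun k => η k = d)
      (M := fun k x => stepBlock w fun l => colorEval η x d B (k :: l))
      (fun k => continuous_stepBlock w fun l => continuous_colorEval η d B _)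
      (fun j hj k x s => by
        simp only [colorEval_update η d B _ (Finset.mem_filter.1 hj).2.ge x s]) hr
    simp only [← stepBlock_sum_smul] at hR
    have hv := ih (.vert :: w) fun w' hw' => hS w' (by simp only [List.length_cons] at hw'; omega)
    have hh := ih (.horiz :: w) fun w' hw' => hS w' (by simp only [List.length_cons] at hw'; omega)
    have hd := ih (.diag :: w) fun w' hw' => hS w' (by simp only [List.length_cons] at hw'; omega)
    rw [List.count_cons_of_ne (by decide)] at hv hh
    rw [List.count_cons_self, pow_succ, mul_assoc] at hd
    have h1 := mul_le_mul_of_nonneg_left hR (pow_nonneg hLp (w.count Step.diag))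
    have h2 := mul_le_mul_of_nonneg_left (add_le_add (add_le_add hv hh) hd) hK
    rw [← mul_add, ← mul_add] at h2
    -- The three branches satisfy the same bound, so their number cancels the 3 in the Rosenthal
    -- inequality.
    have h3 : 3 * ((L ^ (2 * r)) ^ (w.count Step.diag) *
      ∫ x, schattenPow r (stepBlock w (colorEval η x (d + 1) B)) ∂(Measure.pi ν)) ≤
        3 * (((24 * r) ^ (2 * r)) ^ (d + 1) * S) := by
      calc _ = _ := mul_left_comm _ _ _
        _ ≤ _ := h1
        _ = _ := mul_left_comm _ _ _
        _ ≤ _ := h2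
        _ = _ := by ring
    linarith

end StepBlocks

/-! ### Decoupling by averaging over colourings -/

section Decoupling

variable {d n : ℕ} {m q : Type*}

theorem PermSymmetric.eq_of_perm {A : DistinctTuple d n → Matrix m q ℝ} (hA : PermSymmetric A)
    {i i' : DistinctTuple d n} (h : (List.ofFn i).Perm (List.ofFn i')) : A i = A i' := by
  have h1 : ∀ j, ∃ k, i k = i' j := fun j => by
    have : i' j ∈ List.ofFn i := h.mem_iff.2 (by simp)
    simpa using this
  choose g hg using h1
  have hinj : Function.Injective g := fun a b hab => i'.injective (by rw [← hg, ← hg, hab])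
  have hπ := hA (Equiv.ofBijective g (Finite.injective_iff_bijective.1 hinj)) i
  rw [← hπ]
  congr 1
  ext j
  simp [hg]

open Classical in
/-- The coefficients of a symmetric family, indexed by lists instead of tuples of distinct
indices. -/
noncomputable def listCoeff (A : DistinctTuple d n → Matrix m q ℝ) (l : List (Fin n)) :
    Matrix m q ℝ :=
  if h : ∃ i : DistinctTuple d n, (List.ofFn i).Perm l then A h.choose else 0

theorem listCoeff_eq_of_perm {A : DistinctTuple d n → Matrix m q ℝ} (hA : PermSymmetric A)
    {i : DistinctTuple d n} {l : List (Fin n)} (h : (List.ofFn i).Perm l) :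
    listCoeff A l = A i := by
  have h' : ∃ i : DistinctTuple d n, (List.ofFn i).Perm l := ⟨i, h⟩
  rw [listCoeff, dif_pos h']
  exact hA.eq_of_perm (h'.choose_spec.trans h.symm)

theorem listCoeff_eq_zero {A : DistinctTuple d n → Matrix m q ℝ} {l : List (Fin n)}
    (h : ¬ ∃ i : DistinctTuple d n, (List.ofFn i).Perm l) : listCoeff A l = 0 := dif_neg h

theorem permInvariant_listCoeff {A : DistinctTuple d n → Matrix m q ℝ} (hA : PermSymmetric A) :
    PermInvariant (listCoeff A) := by
  intro l l' hl
  by_cases h : ∃ i : DistinctTuple d n, (List.ofFn i).Perm l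
  · obtain ⟨i, hi⟩ := h
    rw [listCoeff_eq_of_perm hA hi, listCoeff_eq_of_perm hA (hi.trans hl)]
  · rw [listCoeff_eq_zero h, listCoeff_eq_zero fun ⟨i, hi⟩ => h ⟨i, hi.trans hl.symm⟩]

theorem colorEval_eq_sum (η : Fin n → ℕ) (x : Fin n → ℝ) (d : ℕ)
    (B : List (Fin n) → Matrix m q ℝ) (l : List (Fin n)) :
    colorEval η x d B l = ∑ i : Fin d → Fin n,
      (∏ j, if η (i j) = (j : ℕ) then x (i j) else 0) • B (List.ofFn i ++ l) := by
  induction d generalizing l with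
  | zero => simp [colorEval]
  | succ d ih =>
    -- The outermost sum of `colorEval` carries the last colour, so tuples are split at their last
    -- entry.
    rw [← (Fin.snocEquiv fun _ : Fin (d + 1) => Fin n).sum_comp, Fintype.sum_prod_type, colorEval,
      Finset.sum_filter]
    refine Finset.sum_congr rfl fun k _ => ?_
    simp only [Fin.snocEquiv_apply, Fin.prod_univ_castSucc, Fin.snoc_castSucc, Fin.snoc_last,
      Fin.val_castSucc, Fin.val_last, List.ofFn_succ', List.concat_eq_append, List.append_assoc,
      List.singleton_append]
    split_ifs
    · rw [ih, Finset.smul_sum]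
      exact Finset.sum_congr rfl fun i _ => by rw [smul_smul, mul_comm]
    · simp

/-- The colours are prescribed on the d values of the tuple and free on the other n - d indices; the
factor d^d on the left avoids the subtraction. -/
theorem card_colorings (i : DistinctTuple d n) :
    d ^ d * (Finset.univ.filter fun η : Fin n → Fin d => ∀ j, η (i j) = j).card = d ^ n := by
  classical
  have h : (Finset.univ.filter fun η : Fin n → Fin d => ∀ j, η (i j) = j) =
      Fintype.piFinset fun k => Finset.univ.filter fun c => ∀ j, i j = k → c = j := by
    ext η
    simp only [Finset.mem_filter, Finset.mem_univ, true_and, Fintype.mem_piFinset]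
    exact ⟨fun h k j hj => by rw [← hj, h j], fun h j => h (i j) j rfl⟩
  have hc : ∀ k, (Finset.univ.filter fun c : Fin d => ∀ j, i j = k → c = j).card =
      if k ∈ Finset.univ.map i then 1 else d := by
    intro k
    split_ifs with hk
    · obtain ⟨j, -, rfl⟩ := Finset.mem_map.1 hk
      rw [Finset.card_eq_one]
      refine ⟨j, ?_⟩
      ext c
      simp only [Finset.mem_filter, Finset.mem_univ, true_and, Finset.mem_singleton,
        EmbeddingLike.apply_eq_iff_eq]
      exact ⟨fun h => h j rfl, fun h j' hj' => h.trans hj'.symm⟩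
    · have : (Finset.univ.filter fun c : Fin d => ∀ j, i j = k → c = j) = Finset.univ := by
        refine Finset.filter_true_of_mem fun c _ j hj => ?_
        exact absurd (Finset.mem_map.2 ⟨j, Finset.mem_univ j, hj⟩) hk
      rw [this, Finset.card_univ, Fintype.card_fin]
  rw [h, Fintype.card_piFinset]
  simp only [hc]
  rw [Finset.prod_ite, Finset.prod_const_one, one_mul, Finset.prod_const, ← pow_add]
  congr 1
  have h1 := Finset.card_filter_add_card_filter_not (s := (Finset.univ : Finset (Fin n)))
    (fun k => k ∈ Finset.univ.map i)
  have h2 : (Finset.univ.filter fun k => k ∈ Finset.univ.map i).card = d := by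
    rw [Finset.filter_mem_eq_inter, Finset.univ_inter, Finset.card_map, Finset.card_univ,
      Fintype.card_fin]
  rw [h2, Finset.card_univ, Fintype.card_fin] at h1
  exact h1

/-- A tuple with a repeated index survives under no colouring, since that index would need two
colours. -/
theorem sum_colorings_prod (i : Fin d → Fin n) (x : Fin n → ℝ) :
    (d : ℝ) ^ d * ∑ η : Fin n → Fin d, ∏ j, (if ((η (i j) : ℕ)) = (j : ℕ) then x (i j) else 0) =
      if Function.Injective i then (d : ℝ) ^ n * ∏ j, x (i j) else 0 := by
  have h : ∀ η : Fin n → Fin d, ∏ j, (if ((η (i j) : ℕ)) = (j : ℕ) then x (i j) else 0) =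
      if ∀ j, η (i j) = j then ∏ j, x (i j) else 0 := by
    intro η
    split_ifs with hη
    · exact Finset.prod_congr rfl fun j _ => by rw [if_pos (by rw [hη j])]
    · obtain ⟨j, hj⟩ := not_forall.1 hη
      exact Finset.prod_eq_zero (Finset.mem_univ j) (if_neg fun hh => hj (Fin.ext hh))
  simp only [h]
  split_ifs with hi
  · have := card_colorings (d := d) ⟨i, hi⟩
    rw [← Finset.sum_filter, Finset.sum_const, nsmul_eq_mul, ← mul_assoc]
    congr 1
    exact_mod_cast this
  · rw [Finset.sum_eq_zero, mul_zero]
    intro η _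
    rw [if_neg]
    intro hη
    exact hi fun a b hab => by rw [← hη a, ← hη b, hab]

theorem evalMatrix_homogPoly (A : DistinctTuple d n → Matrix m q ℝ) (x : Fin n → ℝ) :
    evalMatrix (homogPoly A) x = ∑ i, (∏ j, x (i j)) • A i := by
  ext r s
  simp [evalMatrix, homogPoly, Matrix.sum_apply, mul_comm]

/-- A symmetric multilinear form is an average of its restrictions to the colour classes of random
colourings. -/
theorem evalMatrix_homogPoly_eq_average (hd : 1 ≤ d) {A : DistinctTuple d n → Matrix m q ℝ}
    (hA : PermSymmetric A) (x : Fin n → ℝ) :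
    evalMatrix (homogPoly A) x = (d : ℝ) ^ d • (((Fintype.card (Fin n → Fin d) : ℝ)⁻¹) •
      ∑ η : Fin n → Fin d, colorEval (fun k => (η k : ℕ)) x d (listCoeff A) []) := by
  have hd0 : (d : ℝ) ≠ 0 := by positivity
  simp only [colorEval_eq_sum, List.append_nil]
  rw [Finset.sum_comm, evalMatrix_homogPoly]
  simp only [← Finset.sum_smul]
  rw [Finset.smul_sum, Finset.smul_sum]
  simp only [smul_smul]
  have h : ∀ i : Fin d → Fin n, (d : ℝ) ^ d * ((Fintype.card (Fin n → Fin d) : ℝ)⁻¹ *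
      ∑ η : Fin n → Fin d, ∏ j, (if ((η (i j) : ℕ)) = (j : ℕ) then x (i j) else 0)) =
      if Function.Injective i then ∏ j, x (i j) else 0 := by
    intro i
    rw [mul_left_comm, sum_colorings_prod]
    split_ifs
    · rw [Fintype.card_fun, Fintype.card_fin, Fintype.card_fin, ← mul_assoc]
      push_cast
      rw [inv_mul_cancel₀ (pow_ne_zero _ hd0), one_mul]
    · rw [mul_zero]
  simp only [h, ite_smul, zero_smul]
  rw [← Finset.sum_filter]
  refine Finset.sum_bij (fun i _ => (i : Fin d → Fin n)) (fun i _ => by simpa using i.injective)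
    (fun i _ i' _ h => DFunLike.coe_injective h)
    (fun i hi => ⟨⟨i, (Finset.mem_filter.1 hi).2⟩, Finset.mem_univ _, rfl⟩) fun i _ => ?_
  rw [listCoeff_eq_of_perm hA (List.Perm.refl (List.ofFn i))]

theorem continuous_evalMatrix_homogPoly (A : DistinctTuple d n → Matrix m q ℝ) :
    Continuous fun x => evalMatrix (homogPoly A) x := by
  simp only [evalMatrix_homogPoly]
  fun_prop

/-- Jensen's inequality over colourings raises d^d to the power 2r; each colouring is handled by the
iterated Rosenthal inequality with a constant independent of the colouring. -/
theorem integral_schattenPow_homogPoly_le [Fintype m] [Fintype q] [DecidableEq q]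
    [Nonempty (Fin n)] {L : ℝ} {ν : Fin n → Measure ℝ} (hν : ∀ i, IsStandardBounded L (ν i))
    {r : ℝ} (hr : 4 ≤ r) (hd : 1 ≤ d) {A : DistinctTuple d n → Matrix m q ℝ}
    (hA : PermSymmetric A) {S : ℝ} (hS : ∀ w, w.length = d →
      (L ^ (2 * r)) ^ (w.count Step.diag) * schattenPow r (stepBlock w (listCoeff A)) ≤ S) :
    ∫ x, schattenPow r (evalMatrix (homogPoly A) x) ∂(Measure.pi ν) ≤
      (24 * r * d) ^ (2 * r * d) * S := by
  have : Nonempty (Fin d) := ⟨⟨0, hd⟩⟩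
  set c : ℝ := (Fintype.card (Fin n → Fin d) : ℝ) with hc
  have hc0 : 0 < c := by rw [hc]; exact_mod_cast Fintype.card_pos
  have hcont : ∀ η : Fin n → Fin d, Continuous fun x =>
      schattenPow r (colorEval (fun k => (η k : ℕ)) x d (listCoeff A) []) := fun η =>
    continuous_schattenPow_comp (by linarith) (continuous_colorEval _ d _ _)
  have h1 : ∀ x, schattenPow r (evalMatrix (homogPoly A) x) ≤ ((d : ℝ) ^ d) ^ (2 * r) * (c⁻¹ *
      ∑ η : Fin n → Fin d, schattenPow r (colorEval (fun k => (η k : ℕ)) x d (listCoeff A) [])) := by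
    intro x
    rw [evalMatrix_homogPoly_eq_average hd hA, schattenPow_smul, abs_of_nonneg (by positivity)]
    refine mul_le_mul_of_nonneg_left ?_ (by positivity)
    exact schattenPow_average_le (by linarith) Finset.univ Finset.univ_nonempty _
  have h2 : ∀ η : Fin n → Fin d, ∫ x, schattenPow r
      (colorEval (fun k => (η k : ℕ)) x d (listCoeff A) []) ∂(Measure.pi ν) ≤
        ((24 * r) ^ (2 * r)) ^ d * S := by
    intro η
    have := pow_mul_integral_schattenPow_stepBlock_colorEval_le hν hr (fun k => (η k : ℕ))
      (listCoeff A) d [] (fun w hw => hS w (by simpa using hw))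
    rw [List.count_nil, pow_zero, one_mul] at this
    exact this
  have h3 : ((d : ℝ) ^ d) ^ (2 * r) * ((24 * r) ^ (2 * r)) ^ d = (24 * r * d) ^ (2 * r * d) := by
    rw [← Real.rpow_natCast ((24 * r) ^ (2 * r)), ← Real.rpow_mul (by linarith),
      ← Real.rpow_natCast (d : ℝ) d, ← Real.rpow_mul (by positivity), mul_comm (d : ℝ) (2 * r),
      ← Real.mul_rpow (by positivity) (by linarith), mul_comm (d : ℝ)]
  calc _ ≤ ∫ x, ((d : ℝ) ^ d) ^ (2 * r) * (c⁻¹ * ∑ η : Fin n → Fin d, schattenPow r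
        (colorEval (fun k => (η k : ℕ)) x d (listCoeff A) [])) ∂(Measure.pi ν) :=
        integral_mono (integrable_pi_of_continuous hν (continuous_schattenPow_comp (by linarith)
          (continuous_evalMatrix_homogPoly A))) (integrable_pi_of_continuous hν
          (continuous_const.mul (continuous_const.mul (continuous_finsetSum _ fun η _ => hcont η))))
          h1
    _ = ((d : ℝ) ^ d) ^ (2 * r) * (c⁻¹ * ∑ η : Fin n → Fin d, ∫ x, schattenPow r
        (colorEval (fun k => (η k : ℕ)) x d (listCoeff A) []) ∂(Measure.pi ν)) := by
        rw [integral_const_mul, integral_const_mul,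
          integral_finsetSum _ fun η _ => integrable_pi_of_continuous hν (hcont η)]
    _ ≤ ((d : ℝ) ^ d) ^ (2 * r) * (c⁻¹ * ∑ _η : Fin n → Fin d, ((24 * r) ^ (2 * r)) ^ d * S) := by
        gcongr with η
        exact h2 η
    _ = _ := by
        rw [Finset.sum_const, Finset.card_univ, nsmul_eq_mul, ← hc, inv_mul_cancel_left₀ hc0.ne',
          ← mul_assoc, h3]

end Decoupling

/-! ### Derivative blocks as blocks of coefficients -/

section Derivatives

variable {n : ℕ} {σ m q : Type*}

/-- Iterated partial derivatives, taken from the end of the list to its head. -/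
noncomputable def iterDeriv (v : ℕ → Fin n → σ) (F : MvPolynomial σ ℝ) :
    List (Fin n) → MvPolynomial σ ℝ
  | [] => F
  | k :: l => MvPolynomial.pderiv (v l.length k) (iterDeriv v F l)

/-- The exponents of the monomial of the variables used by `iterDeriv`. -/
noncomputable def derivExponent (v : ℕ → Fin n → σ) : List (Fin n) → σ →₀ ℕ
  | [] => 0
  | k :: l => Finsupp.single (v l.length k) 1 + derivExponent v l

theorem stepBlock_congr {R : Type*} [Zero R] (w : List Step) {B B' : List (Fin n) → Matrix m q R}
    (h : ∀ l, l.length = w.length → B l = B' l) : stepBlock w B = stepBlock w B' := by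
  induction w generalizing B B' with
  | nil => exact h [] rfl
  | cons s w ih =>
    have h' : ∀ k, stepBlock w (fun l => B (k :: l)) = stepBlock w fun l => B' (k :: l) :=
      fun k => ih fun l hl => h _ (by simp [hl])
    cases s
    · exact congr_arg vertBlock (funext h')
    · exact congr_arg horizBlock (funext h')
    · exact congr_arg diagBlock (funext h')

/-- Differentiation is entrywise and fixes the zero blocks, so it commutes with block assembly. -/
theorem derivMatrix_apply (v : ℕ → Fin n → σ) (F : Matrix m q (MvPolynomial σ ℝ))
    (w : List Step) : derivMatrix v F w =
      stepBlock w fun l => Matrix.of fun r s => iterDeriv v (F r s) l := by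
  have key : ∀ (w : List Step) (B : List (Fin n) → Matrix m q (MvPolynomial σ ℝ)) (k : Fin n)
      (i : RowIdx n m w) (j : ColIdx n q w), MvPolynomial.pderiv (v w.length k) (stepBlock w B i j) =
        stepBlock w (fun l => (B l).map (MvPolynomial.pderiv (v w.length k))) i j := by
    intro w B k
    generalize v w.length k = a
    induction w generalizing B with
    | nil => exact fun i j => rfl
    | cons s w ih =>
      intro i j
      cases s
      · exact ih _ i.2 j
      · exact ih _ i j.2
      · change MvPolynomial.pderiv a (if i.1 = j.1 then _ else 0) = if i.1 = j.1 then _ else 0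
        split_ifs
        · exact ih _ i.2 j.2
        · simp
  have key' : ∀ (w : List Step) (k : Fin n) (i : RowIdx n m w) (j : ColIdx n q w),
      MvPolynomial.pderiv (v w.length k) (stepBlock w
        (fun l => Matrix.of fun r s => iterDeriv v (F r s) l) i j) =
      stepBlock w (fun l => Matrix.of fun r s => iterDeriv v (F r s) (k :: l)) i j := by
    intro w k i j
    rw [key]
    refine congr_fun₂ (stepBlock_congr w fun l hl => ?_) i j
    ext r s
    simp [iterDeriv, hl]
  induction w with
  | nil => rfl
  | cons s w ih =>
    ext1 i j
    cases s
    · exact (congr_arg _ (congr_fun₂ ih i.2 j)).trans (key' w i.1 i.2 j)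
    · exact (congr_arg _ (congr_fun₂ ih i j.2)).trans (key' w j.1 i j.2)
    · exact if_congr Iff.rfl ((congr_arg _ (congr_fun₂ ih i.2 j.2)).trans
        (key' w i.1 i.2 j.2)) rfl

theorem constMatrix_stepBlock (w : List Step)
    (B : List (Fin n) → Matrix m q (MvPolynomial σ ℝ)) :
    constMatrix (stepBlock w B) = stepBlock w fun l => constMatrix (B l) := by
  induction w generalizing B with
  | nil => rfl
  | cons s w ih =>
    ext1 i j
    cases s
    · exact congr_fun₂ (ih _) i.2 j
    · exact congr_fun₂ (ih _) i j.2
    · change MvPolynomial.constantCoeff (if i.1 = j.1 then _ else 0) = if i.1 = j.1 then _ else 0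
      split_ifs
      · exact congr_fun₂ (ih _) i.2 j.2
      · simp

/-- The unspecified multiplicity is enough to deduce that a derivative coefficient vanishes. -/
theorem exists_coeff_iterDeriv (v : ℕ → Fin n → σ) (F : MvPolynomial σ ℝ) (l : List (Fin n))
    (e : σ →₀ ℕ) : ∃ c : ℝ, (iterDeriv v F l).coeff e = c * F.coeff (e + derivExponent v l) := by
  induction l generalizing e with
  | nil => exact ⟨1, by simp [iterDeriv, derivExponent]⟩
  | cons k l ih =>
    obtain ⟨c, hc⟩ := ih (e + Finsupp.single (v l.length k) 1)
    refine ⟨(e (v l.length k) + 1) * c, ?_⟩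
    rw [iterDeriv, MvPolynomial.coeff_pderiv, hc, derivExponent, add_assoc]
    ring

/-- For a squarefree total exponent every multiplicity factor produced by differentiation is one. -/
theorem coeff_iterDeriv (v : ℕ → Fin n → σ) (F : MvPolynomial σ ℝ) (l : List (Fin n))
    (e : σ →₀ ℕ) (h : ∀ a, e a + derivExponent v l a ≤ 1) :
    (iterDeriv v F l).coeff e = F.coeff (e + derivExponent v l) := by
  induction l generalizing e with
  | nil => simp [iterDeriv, derivExponent]
  | cons k l ih =>
    rw [iterDeriv, MvPolynomial.coeff_pderiv, ih, derivExponent, add_assoc]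
    · have := h (v l.length k)
      simp only [derivExponent, Finsupp.add_apply, Finsupp.single_eq_same] at this
      have h0 : e (v l.length k) = 0 := by omega
      rw [h0]
      simp
    · intro a
      have := h a
      simpa [derivExponent, add_assoc] using this

/-- If all coefficients of non-squarefree monomials vanish, then the constant terms of iterated
derivatives are coefficients. -/
theorem constantCoeff_iterDeriv (v : ℕ → Fin n → σ) (F : MvPolynomial σ ℝ)
    (hF : ∀ e : σ →₀ ℕ, (∃ a, 1 < e a) → F.coeff e = 0) (l : List (Fin n)) :
    MvPolynomial.constantCoeff (iterDeriv v F l) = F.coeff (derivExponent v l) := by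
  rw [MvPolynomial.constantCoeff_eq]
  by_cases h : ∀ a, derivExponent v l a ≤ 1
  · rw [coeff_iterDeriv v F l 0 (by simpa using h), zero_add]
  · push Not at h
    obtain ⟨c, hc⟩ := exists_coeff_iterDeriv v F l 0
    rw [hc, zero_add, hF _ h, mul_zero]

theorem prod_X_eq_monomial {ι : Type*} [Fintype ι] (f : ι → σ) :
    ∏ j, (MvPolynomial.X (f j) : MvPolynomial σ ℝ) =
      MvPolynomial.monomial (∑ j, Finsupp.single (f j) 1) 1 := by
  rw [MvPolynomial.monomial_sum_one]
  rfl

theorem sum_single_apply_le_one {ι : Type*} [Fintype ι] {f : ι → σ} (hf : Function.Injective f)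
    (a : σ) : (∑ j, Finsupp.single (f j) 1 : σ →₀ ℕ) a ≤ 1 := by
  classical
  rw [Finsupp.finsetSum_apply]
  simp only [Finsupp.single_apply]
  rw [← Finset.card_filter]
  exact Finset.card_le_one.2 fun i hi j hj => hf (by simp_all)

theorem coeff_sum_C_mul_prod_X {κ ι : Type*} [Fintype κ] [Fintype ι] [DecidableEq (σ →₀ ℕ)]
    (c : κ → ℝ) (f : κ → ι → σ) (e : σ →₀ ℕ) :
    (∑ i, MvPolynomial.C (c i) * ∏ j, MvPolynomial.X (f i j)).coeff e =
      ∑ i, if ∑ j, Finsupp.single (f i j) 1 = e then c i else 0 := by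
  classical
  simp only [prod_X_eq_monomial, MvPolynomial.coeff_sum, MvPolynomial.coeff_C_mul]
  refine Finset.sum_congr rfl fun i _ => ?_
  rw [MvPolynomial.coeff_monomial]
  split_ifs <;> simp

theorem derivExponent_fst (l : List (Fin n)) :
    derivExponent (fun _ k => k) l = Multiset.toFinsupp (l : Multiset (Fin n)) := by
  induction l with
  | nil => simp [derivExponent]
  | cons k l ih =>
    rw [derivExponent, ih, ← Multiset.cons_coe, ← Multiset.singleton_add, map_add,
      Multiset.toFinsupp_singleton]

/-- The head of the list is the last step and hence uses the last copy of the variables; this causes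
the reversal. -/
theorem derivExponent_mk_ofFn_rev {d : ℕ} (i : Fin d → Fin n) :
    derivExponent Prod.mk (List.ofFn fun j => i (Fin.rev j)) =
      ∑ j : Fin d, Finsupp.single ((j : ℕ), i j) 1 := by
  induction d with
  | zero => simp [derivExponent]
  | succ d ih =>
    rw [List.ofFn_succ, derivExponent, Fin.sum_univ_castSucc, List.length_ofFn, Fin.rev_zero,
      add_comm]
    congr 1
    have := ih fun j => i (Fin.castSucc j)
    simpa [Fin.rev_succ] using this

variable {d : ℕ}

theorem sum_single_eq_toFinsupp (i : Fin d → Fin n) :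
    ∑ j, Finsupp.single (i j) 1 = Multiset.toFinsupp ((List.ofFn i : List (Fin n)) : Multiset (Fin n)) := by
  induction d with
  | zero => simp
  | succ d ih =>
    rw [Fin.sum_univ_succ, List.ofFn_succ, ← Multiset.cons_coe, ← Multiset.singleton_add, map_add,
      Multiset.toFinsupp_singleton, ih]

/-- The source of d!: the tuples rearranging a given list of distinct indices form one free orbit of
the permutation group. -/
theorem sum_ite_perm_eq {A : DistinctTuple d n → Matrix m q ℝ} (hA : PermSymmetric A)
    (l : List (Fin n)) (r : m) (s : q) :
    (∑ i : DistinctTuple d n, if (List.ofFn i).Perm l then A i r s else 0) =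
      (d.factorial : ℝ) * listCoeff A l r s := by
  by_cases h : ∃ i : DistinctTuple d n, (List.ofFn i).Perm l
  · obtain ⟨i, hi⟩ := h
    rw [listCoeff_eq_of_perm hA hi, ← Finset.sum_filter]
    have hinj : Function.Injective fun π : Equiv.Perm (Fin d) => π.toEmbedding.trans i := by
      intro π π' h
      ext j
      have := DFunLike.congr_fun h j
      simpa [Fin.ext_iff] using this
    have himg : (Finset.univ.filter fun i' : DistinctTuple d n => (List.ofFn i').Perm l) =
        Finset.univ.map ⟨_, hinj⟩ := by
      ext i'
      simp only [Finset.mem_filter, Finset.mem_univ, true_and, Finset.mem_map,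
        Function.Embedding.coeFn_mk]
      constructor
      · intro hi'
        have h1 : ∀ j, ∃ k, i k = i' j := fun j => by
          have : i' j ∈ List.ofFn i := (hi.trans hi'.symm).mem_iff.2 (by simp)
          simpa using this
        choose g hg using h1
        have hginj : Function.Injective g := fun a b hab => i'.injective (by rw [← hg, ← hg, hab])
        refine ⟨Equiv.ofBijective g (Finite.injective_iff_bijective.1 hginj), ?_⟩
        ext j
        simp [hg]
      · rintro ⟨π, rfl⟩
        exact (Equiv.Perm.ofFn_comp_perm π i).trans hi
    rw [himg, Finset.sum_map]
    have hconst : ∀ π : Equiv.Perm (Fin d), A (π.toEmbedding.trans i) r s = A i r s :=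
      fun π => by rw [hA]
    simp only [Function.Embedding.coeFn_mk, hconst]
    rw [Finset.sum_const, Finset.card_univ, Fintype.card_perm, Fintype.card_fin, nsmul_eq_mul]
  · rw [listCoeff_eq_zero h, Finset.sum_eq_zero]
    · simp
    · intro i _
      rw [if_neg fun hi => h ⟨i, hi⟩]

theorem coeff_homogPoly_eq_zero (A : DistinctTuple d n → Matrix m q ℝ) (r : m) (s : q)
    (e : Fin n →₀ ℕ) (he : ∃ a, 1 < e a) : (homogPoly A r s).coeff e = 0 := by
  classical
  rw [homogPoly, Matrix.of_apply, coeff_sum_C_mul_prod_X]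
  refine Finset.sum_eq_zero fun i _ => if_neg ?_
  rintro rfl
  obtain ⟨a, ha⟩ := he
  exact absurd (sum_single_apply_le_one i.injective a) (by omega)

theorem coeff_decoupledPoly_eq_zero (A : DistinctTuple d n → Matrix m q ℝ) (r : m) (s : q)
    (e : ℕ × Fin n →₀ ℕ) (he : ∃ a, 1 < e a) : (decoupledPoly A r s).coeff e = 0 := by
  classical
  rw [decoupledPoly, Matrix.of_apply, coeff_sum_C_mul_prod_X (fun i => A i r s)
      (fun (i : DistinctTuple d n) (j : Fin d) => ((j : ℕ), i j))]
  refine Finset.sum_eq_zero fun i _ => if_neg ?_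
  rintro rfl
  obtain ⟨a, ha⟩ := he
  have hinj : Function.Injective fun j : Fin d => ((j : ℕ), i j) := fun j j' h =>
    Fin.ext (congr_arg Prod.fst h)
  exact absurd (sum_single_apply_le_one hinj a) (by omega)

/-- The block matrix of partial derivatives of a symmetric multilinear form. -/
theorem partialBlock_eq {A : DistinctTuple d n → Matrix m q ℝ} (hA : PermSymmetric A)
    (w : List Step) : partialBlock A w = (d.factorial : ℝ) • stepBlock w (listCoeff A) := by
  classical
  rw [partialBlock, derivMatrix_apply, constMatrix_stepBlock, ← stepBlock_smul]
  congr 1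
  ext l r s
  rw [constMatrix, Matrix.map_apply, Matrix.of_apply,
    constantCoeff_iterDeriv _ _ (coeff_homogPoly_eq_zero A r s), Matrix.smul_apply, smul_eq_mul,
    ← sum_ite_perm_eq hA, homogPoly, Matrix.of_apply, coeff_sum_C_mul_prod_X]
  refine Finset.sum_congr rfl fun i _ => ?_
  congr 1
  rw [sum_single_eq_toFinsupp, derivExponent_fst, EmbeddingLike.apply_eq_iff_eq, Multiset.coe_eq_coe]

/-- Labelled copies let the exponent determine the tuple, so no factorial appears. That tuple is the
list reversed, which symmetry identifies with the list itself; lists with repetitions give zero on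
both sides. -/
theorem decoupledBlock_eq {A : DistinctTuple d n → Matrix m q ℝ} (hA : PermSymmetric A)
    {w : List Step} (hw : w.length = d) : decoupledBlock A w = stepBlock w (listCoeff A) := by
  classical
  rw [decoupledBlock, derivMatrix_apply, constMatrix_stepBlock]
  refine stepBlock_congr w fun l hl => ?_
  rw [hw] at hl
  subst hl
  set k : Fin l.length → Fin n := fun j => l.get (Fin.rev j) with hk
  have hlk : l = List.ofFn fun j => k (Fin.rev j) := by
    simp only [hk, Fin.rev_rev]
    exact (List.ofFn_get l).symm
  have hperm : (List.ofFn k).Perm l := by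
    conv_rhs => rw [hlk]
    exact (Equiv.Perm.ofFn_comp_perm Fin.revPerm k).symm
  have hexp : derivExponent Prod.mk l = ∑ j : Fin l.length, Finsupp.single ((j : ℕ), k j) 1 := by
    conv_lhs => rw [hlk]
    exact derivExponent_mk_ofFn_rev k
  have hiff : ∀ i : DistinctTuple l.length n,
      (∑ j : Fin l.length, Finsupp.single ((j : ℕ), i j) 1 : ℕ × Fin n →₀ ℕ) = derivExponent Prod.mk l ↔
        (i : Fin l.length → Fin n) = k := by
    intro i
    rw [hexp]
    refine ⟨fun h => ?_, fun h => by rw [h]⟩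
    ext1 j
    have h1 : ∀ f : Fin l.length → Fin n,
        (∑ j : Fin l.length, Finsupp.single ((j : ℕ), f j) 1 : ℕ × Fin n →₀ ℕ) ((j : ℕ), i j) =
          if f j = i j then 1 else 0 := by
      intro f
      rw [Finsupp.finsetSum_apply, Finset.sum_eq_single j]
      · simp [Finsupp.single_apply]
      · intro j' _ hj'
        rw [Finsupp.single_apply, if_neg fun h => hj' (Fin.ext (congr_arg Prod.fst h))]
      · simp
    have h2 := DFunLike.congr_fun h ((j : ℕ), i j)
    rw [h1, h1, if_pos rfl] at h2
    by_contra hne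
    rw [if_neg (Ne.symm hne)] at h2
    exact one_ne_zero h2
  ext r s
  rw [constMatrix, Matrix.map_apply, Matrix.of_apply,
    constantCoeff_iterDeriv _ _ (coeff_decoupledPoly_eq_zero A r s), decoupledPoly,
    Matrix.of_apply, coeff_sum_C_mul_prod_X (fun i => A i r s)
      (fun (i : DistinctTuple l.length n) (j : Fin l.length) => ((j : ℕ), i j))]
  simp only [hiff]
  by_cases h : Function.Injective k
  · have h1 : ∀ i : DistinctTuple l.length n, (i : Fin l.length → Fin n) = k ↔ i = ⟨k, h⟩ :=
      fun i => ⟨fun h => DFunLike.coe_injective h, fun h => by rw [h]; rfl⟩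
    simp only [h1]
    rw [Finset.sum_ite_eq', if_pos (Finset.mem_univ _), listCoeff_eq_of_perm hA (i := ⟨k, h⟩) hperm]
  · rw [Finset.sum_eq_zero, listCoeff_eq_zero]
    · rfl
    · rintro ⟨i, hi⟩
      have h1 : (List.ofFn k).Nodup := (hi.trans hperm.symm).nodup_iff.1
        (List.nodup_ofFn.2 i.injective)
      exact h (List.nodup_ofFn.1 h1)
    · intro i _
      refine if_neg fun hi => h ?_
      rw [← hi]
      exact i.injective

end Derivatives

/-! ### Assembly of the moment bound -/

section Main

theorem isStandardBounded_map {Ω : Type*} [MeasurableSpace Ω] {μ : Measure Ω}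
    [IsProbabilityMeasure μ] {L : ℝ} {X : Ω → ℝ} (hX : Measurable X) (hmean : ∫ ω, X ω ∂μ = 0)
    (hvar : ∫ ω, X ω ^ 2 ∂μ = 1) (hbound : ∀ᵐ ω ∂μ, |X ω| ≤ L) :
    IsStandardBounded L (μ.map X) where
  isProbabilityMeasure := Measure.isProbabilityMeasure_map hX.aemeasurable
  ae_abs_le := (ae_map_iff hX.aemeasurable
    (measurableSet_le (by fun_prop) measurable_const)).2 hbound
  integral_id := by
    rw [integral_map hX.aemeasurable (by fun_prop)]
    exact hmean
  integral_sq := by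
    rw [integral_map hX.aemeasurable (by fun_prop)]
    exact hvar

variable {d n : ℕ} {m q : Type*}

/-- The indices are distinct, so the variable of the first index occurs exactly once in a monomial
and can be integrated out. -/
theorem integral_evalMatrix_homogPoly_eq_zero {L : ℝ} {ν : Fin n → Measure ℝ}
    (hν : ∀ i, IsStandardBounded L (ν i)) (hd : 1 ≤ d) (A : DistinctTuple d n → Matrix m q ℝ)
    (r : m) (s : q) : ∫ x, evalMatrix (homogPoly A) x r s ∂(Measure.pi ν) = 0 := by
  simp only [evalMatrix_homogPoly, Matrix.sum_apply, Matrix.smul_apply, smul_eq_mul]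
  rw [integral_finsetSum _ fun i _ => integrable_pi_of_continuous hν (by fun_prop)]
  refine Finset.sum_eq_zero fun i _ => ?_
  rw [integral_mul_const]
  convert zero_mul _
  rw [integral_pi_eq_integral_update hν (i ⟨0, hd⟩) (by fun_prop)]
  have h : ∀ (x : Fin n → ℝ) (t : ℝ), ∏ j, Function.update x (i ⟨0, hd⟩) t (i j) =
      t * ∏ j ∈ Finset.univ.erase ⟨0, hd⟩, x (i j) := by
    intro x t
    rw [← Finset.mul_prod_erase _ _ (Finset.mem_univ (⟨0, hd⟩ : Fin d)), Function.update_self]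
    congr 1
    refine Finset.prod_congr rfl fun j hj => ?_
    rw [Function.update_of_ne fun h => Finset.ne_of_mem_erase hj (i.injective h)]
  simp only [h, integral_mul_const, (hν _).integral_id, zero_mul, integral_zero]

theorem evalMatrix_multilinearPoly (D : ℕ) (A : (d : ℕ) → DistinctTuple d n → Matrix m q ℝ)
    (x : Fin n → ℝ) : evalMatrix (multilinearPoly D A) x =
      ∑ d ∈ Finset.Icc 1 D, evalMatrix (homogPoly (A d)) x := by
  ext r s
  simp [evalMatrix, multilinearPoly, Matrix.sum_apply]

theorem count_vert_add_count_horiz_add_count_diag (w : List Step) :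
    w.count .vert + w.count .horiz + w.count .diag = w.length := by
  induction w with
  | nil => rfl
  | cons s w ih => cases s <;> simp [← ih] <;> omega

/-- Jensen's inequality applied to the mean of the D parts; the remaining factor 1/D is discarded.
-/
theorem schattenPow_sum_le [Fintype m] [Fintype q] [DecidableEq q] {r : ℝ} (hr : 1 < r) (D : ℕ)
    (M : ℕ → Matrix m q ℝ) : schattenPow r (∑ d ∈ Finset.Icc 1 D, M d) ≤
      (D : ℝ) ^ (2 * r) * ∑ d ∈ Finset.Icc 1 D, schattenPow r (M d) := by
  rcases Nat.eq_zero_or_pos D with rfl | hD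
  · simp [schattenPow_zero (show 0 < r by linarith)]
  · have hD' : (1 : ℝ) ≤ D := by exact_mod_cast hD
    have hcard : (Finset.Icc 1 D).card = D := by simp
    have h := schattenPow_average_le hr (Finset.Icc 1 D) (Finset.nonempty_Icc.2 hD) M
    rw [hcard] at h
    have h0 : 0 ≤ ∑ d ∈ Finset.Icc 1 D, schattenPow r (M d) :=
      Finset.sum_nonneg fun d _ => schattenPow_nonneg r _
    calc _ = schattenPow r ((D : ℝ) • ((D : ℝ)⁻¹ • ∑ d ∈ Finset.Icc 1 D, M d)) := by
          rw [smul_smul, mul_inv_cancel₀ (by linarith), one_smul]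
      _ = (D : ℝ) ^ (2 * r) * schattenPow r ((D : ℝ)⁻¹ • ∑ d ∈ Finset.Icc 1 D, M d) := by
          rw [schattenPow_smul, abs_of_nonneg (by linarith)]
      _ ≤ _ := by
          refine mul_le_mul_of_nonneg_left (h.trans ?_) (by positivity)
          exact mul_le_of_le_one_left h0 (inv_le_one_of_one_le₀ hD')

variable [Fintype m] [Fintype q] [DecidableEq q]

theorem rpow_mul_le_sum_triples {L t : ℝ} (hL : 0 ≤ L) {φ : ℕ → ℕ → ℕ → ℝ}
    (hφ : ∀ a b c, 0 ≤ φ a b c) {a b c : ℕ} (h : (a, b, c) ∈ triples d) :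
    L ^ (4 * (c : ℝ) * t) * φ a b c ≤
      ∑ u ∈ triples d, L ^ (4 * u.2.2 * t) * φ u.1 u.2.1 u.2.2 := by
  have hnn : ∀ u ∈ triples d, 0 ≤ L ^ (4 * (u.2.2 : ℝ) * t) * φ u.1 u.2.1 u.2.2 :=
    fun u _ => mul_nonneg (Real.rpow_nonneg hL _) (hφ _ _ _)
  have key := Finset.single_le_sum hnn h
  exact key

/-- Without variables nothing forces L ≥ 1, so this case is separated; all coefficients then vanish.
-/
theorem schattenPow_stepBlock_eq_zero {r : ℝ} (hr : 0 < r) [IsEmpty (Fin n)] (hd : 1 ≤ d)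
    (A : DistinctTuple d n → Matrix m q ℝ) (w : List Step) :
    schattenPow r (stepBlock w (listCoeff A)) = 0 := by
  have h : listCoeff A = fun _ => (0 : ℝ) • 0 := by
    ext1 l
    rw [zero_smul]
    exact listCoeff_eq_zero fun ⟨i, _⟩ => isEmptyElim (i ⟨0, hd⟩)
  rw [h, stepBlock_smul, zero_smul, schattenPow_zero hr]

theorem integral_schattenPow_homogPoly_le_sum {L : ℝ} {ν : Fin n → Measure ℝ}
    (hν : ∀ i, IsStandardBounded L (ν i)) {t : ℝ} (ht : 2 ≤ t) (hd : 1 ≤ d)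
    {A : DistinctTuple d n → Matrix m q ℝ} (hA : PermSymmetric A)
    (W : ℕ → ℕ → ℕ → List Step)
    (hW : ∀ a b c, (W a b c).count Step.vert = a ∧ (W a b c).count Step.horiz = b ∧
      (W a b c).count Step.diag = c) :
    ∫ x, schattenPow (2 * t) (evalMatrix (homogPoly A) x) ∂(Measure.pi ν) ≤
      (48 * d * t) ^ (4 * d * t) * ∑ u ∈ triples d, L ^ (4 * u.2.2 * t) *
        schattenPow (2 * t) (stepBlock (W u.1 u.2.1 u.2.2) (listCoeff A)) := by
  rcases isEmpty_or_nonempty (Fin n) with hn | hn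
  · have h1 : ∀ x, evalMatrix (homogPoly A) x = 0 := fun x => by
      rw [evalMatrix_homogPoly]
      exact Finset.sum_eq_zero fun i _ => isEmptyElim (i ⟨0, hd⟩)
    simp [h1, schattenPow_zero (show 0 < 2 * t by linarith),
      schattenPow_stepBlock_eq_zero (show 0 < 2 * t by linarith) hd A]
  · have hL : 1 ≤ L := (hν (Classical.arbitrary _)).one_le
    -- With r = 2t, the whole sum over triples serves as the common bound for the leaves: each
    -- weighted leaf equals one of its nonnegative terms.
    have h := integral_schattenPow_homogPoly_le hν (r := 2 * t) (by linarith) hd hA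
      (S := ∑ u ∈ triples d, L ^ (4 * u.2.2 * t) *
        schattenPow (2 * t) (stepBlock (W u.1 u.2.1 u.2.2) (listCoeff A))) ?_
    · refine h.trans (le_of_eq ?_)
      congr 2 <;> ring
    · intro w hw
      have hcount := count_vert_add_count_horiz_add_count_diag w
      have hmem : (w.count .vert, w.count .horiz, w.count .diag) ∈ triples d := by
        simp only [triples, Finset.mem_filter, Finset.mem_product, Finset.mem_range]
        omega
      have hperm : w.Perm (W (w.count .vert) (w.count .horiz) (w.count .diag)) := by
        obtain ⟨h1, h2, h3⟩ := hW (w.count .vert) (w.count .horiz) (w.count .diag)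
        refine List.perm_iff_count.2 fun s => ?_
        cases s
        · exact h1.symm
        · exact h2.symm
        · exact h3.symm
      rw [schattenPow_stepBlock_eq_of_perm (by linarith) hperm (permInvariant_listCoeff hA)]
      have hexp : (L ^ (2 * (2 * t))) ^ (w.count Step.diag) =
          L ^ (4 * (w.count Step.diag : ℝ) * t) := by
        rw [← Real.rpow_natCast, ← Real.rpow_mul (by linarith)]
        congr 1
        ring
      rw [hexp]
      exact rpow_mul_le_sum_triples (by linarith)
        (φ := fun a b c => schattenPow (2 * t) (stepBlock (W a b c) (listCoeff A)))
        (fun _ _ _ => schattenPow_nonneg _ _) hmem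

/-- Ordinary derivative blocks carry an extra factor d! ≥ 1, so the bound through them follows from
the bound through coefficient blocks. -/
theorem rpow_mul_schattenPow_stepBlock_le_partialBlock {L : ℝ} {ν : Fin n → Measure ℝ}
    (hν : ∀ i, IsStandardBounded L (ν i)) {r : ℝ} (hr : 0 < r) (hd : 1 ≤ d)
    {A : DistinctTuple d n → Matrix m q ℝ} (hA : PermSymmetric A) (w : List Step) (e : ℝ) :
    L ^ e * schattenPow r (stepBlock w (listCoeff A)) ≤
      L ^ e * schattenPow r (partialBlock A w) := by
  rw [partialBlock_eq hA, schattenPow_smul]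
  rcases isEmpty_or_nonempty (Fin n) with hn | hn
  · simp [schattenPow_stepBlock_eq_zero hr hd A]
  · have hL : 1 ≤ L := (hν (Classical.arbitrary _)).one_le
    refine mul_le_mul_of_nonneg_left ?_ (Real.rpow_nonneg (by linarith) _)
    refine le_mul_of_one_le_left (schattenPow_nonneg _ _) (Real.one_le_rpow ?_ (by linarith))
    rw [Nat.abs_cast]
    exact_mod_cast Nat.factorial_pos d

end Main

theorem mainTheorem4 {Ω : Type*} [MeasurableSpace Ω] (μ : Measure Ω) [IsProbabilityMeasure μ]
    {m q : Type*} [Fintype m] [Fintype q] [DecidableEq q]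
    (n D : ℕ) (L : ℝ)
    -- the i.i.d. centred, normalized, bounded random variables
    (x : Fin n → Ω → ℝ) (hmeas : ∀ i, Measurable (x i)) (hindep : iIndepFun x μ)
    (hident : ∀ i j, IdentDistrib (x i) (x j) μ μ)
    (hmean : ∀ i, ∫ ω, x i ω ∂μ = 0) (hvar : ∀ i, ∫ ω, (x i ω) ^ 2 ∂μ = 1)
    (hbound : ∀ i, ∀ᵐ ω ∂μ, |x i ω| ≤ L)
    -- the permutation-symmetric matrix coefficients of the homogeneous parts
    (A : (d : ℕ) → DistinctTuple d n → Matrix m q ℝ)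
    (hsymm : ∀ d, 1 ≤ d → d ≤ D → PermSymmetric (A d))
    -- for each `(a, b, c)`, any order of `a` vertical, `b` horizontal and `c` diagonal steps
    (W : ℕ → ℕ → ℕ → List Step)
    (hW : ∀ a b c, (W a b c).count Step.vert = a ∧ (W a b c).count Step.horiz = b ∧
      (W a b c).count Step.diag = c)
    (t : ℝ) (ht : 2 ≤ t) :
    let F : Ω → Matrix m q ℝ := fun ω => evalMatrix (multilinearPoly D A) (fun i => x i ω)
    Integrable (fun ω => schattenNorm (4 * t) (F ω - expectedMatrix μ F) ^ (4 * t)) μ ∧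
    -- the blocks are the partial derivatives of the homogeneous parts
    ∫ ω, schattenNorm (4 * t) (F ω - expectedMatrix μ F) ^ (4 * t) ∂μ ≤
      ∑ d ∈ Finset.Icc 1 D, (D : ℝ) ^ (4 * t) * (48 * d * t) ^ (4 * d * t) *
        ∑ u ∈ triples d, L ^ (4 * u.2.2 * t) *
          schattenNorm (4 * t) (partialBlock (A d) (W u.1 u.2.1 u.2.2)) ^ (4 * t) ∧
    -- the blocks are the partial derivatives of the decoupled homogeneous parts
    ∫ ω, schattenNorm (4 * t) (F ω - expectedMatrix μ F) ^ (4 * t) ∂μ ≤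
      ∑ d ∈ Finset.Icc 1 D, (D : ℝ) ^ (4 * t) * (48 * d * t) ^ (4 * d * t) *
        ∑ u ∈ triples d, L ^ (4 * u.2.2 * t) *
          schattenNorm (4 * t) (decoupledBlock (A d) (W u.1 u.2.1 u.2.2)) ^ (4 * t) := by
  intro F
  have h4t : 4 * t / 2 = 2 * t := by ring
  simp only [schattenNorm_rpow_eq (show 0 < 4 * t by linarith), h4t]
  set ν : Fin n → Measure ℝ := fun i => μ.map (x i) with hνdef
  have hν : ∀ i, IsStandardBounded L (ν i) := fun i =>
    isStandardBounded_map (hmeas i) (hmean i) (hvar i) (hbound i)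
  have hX : Measurable fun ω i => x i ω := measurable_pi_lambda _ hmeas
  have hmap : μ.map (fun ω i => x i ω) = Measure.pi ν :=
    (iIndepFun_iff_map_fun_eq_pi_map fun i => (hmeas i).aemeasurable).1 hindep
  have hint : ∀ g : (Fin n → ℝ) → ℝ, Continuous g →
      ∫ ω, g (fun i => x i ω) ∂μ = ∫ y, g y ∂(Measure.pi ν) := fun g hg => by
    rw [← hmap, integral_map hX.aemeasurable hg.measurable.aestronglyMeasurable]
  have hcont : Continuous fun y : Fin n → ℝ => evalMatrix (multilinearPoly D A) y := by
    simp only [evalMatrix_multilinearPoly]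
    exact continuous_finsetSum _ fun d _ => continuous_evalMatrix_homogPoly (A d)
  have hexp : expectedMatrix μ F = 0 := by
    ext r s
    rw [expectedMatrix, Matrix.of_apply, hint (fun y => evalMatrix (multilinearPoly D A) y r s)
      (hcont.matrix_elem r s)]
    simp only [evalMatrix_multilinearPoly, Matrix.sum_apply]
    rw [integral_finsetSum _ fun d _ => integrable_pi_of_continuous hν
      ((continuous_evalMatrix_homogPoly (A d)).matrix_elem r s)]
    exact Finset.sum_eq_zero fun d hd =>
      integral_evalMatrix_homogPoly_eq_zero hν (Finset.mem_Icc.1 hd).1 (A d) r s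
  have hcΦ : Continuous fun y : Fin n → ℝ =>
      schattenPow (2 * t) (evalMatrix (multilinearPoly D A) y) :=
    continuous_schattenPow_comp (by linarith) hcont
  have hcd : ∀ d, Continuous fun y : Fin n → ℝ =>
      schattenPow (2 * t) (evalMatrix (homogPoly (A d)) y) := fun d =>
    continuous_schattenPow_comp (by linarith) (continuous_evalMatrix_homogPoly (A d))
  simp only [hexp, sub_zero]
  have key : ∫ ω, schattenPow (2 * t) (F ω) ∂μ ≤
      ∑ d ∈ Finset.Icc 1 D, (D : ℝ) ^ (4 * t) * (48 * d * t) ^ (4 * d * t) *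
        ∑ u ∈ triples d, L ^ (4 * u.2.2 * t) *
          schattenPow (2 * t) (stepBlock (W u.1 u.2.1 u.2.2) (listCoeff (A d))) := by
    calc _ = ∫ y, schattenPow (2 * t) (evalMatrix (multilinearPoly D A) y) ∂(Measure.pi ν) :=
          hint _ hcΦ
      _ ≤ ∫ y, (D : ℝ) ^ (4 * t) * ∑ d ∈ Finset.Icc 1 D,
            schattenPow (2 * t) (evalMatrix (homogPoly (A d)) y) ∂(Measure.pi ν) := by
          refine integral_mono (integrable_pi_of_continuous hν hcΦ)
            (integrable_pi_of_continuous hν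
              (continuous_const.mul (continuous_finsetSum _ fun d _ => hcd d))) fun y => ?_
          have h := schattenPow_sum_le (r := 2 * t) (by linarith) D
            fun d => evalMatrix (homogPoly (A d)) y
          rw [show 2 * (2 * t) = 4 * t by ring, ← evalMatrix_multilinearPoly] at h
          exact h
      _ = ∑ d ∈ Finset.Icc 1 D, (D : ℝ) ^ (4 * t) *
            ∫ y, schattenPow (2 * t) (evalMatrix (homogPoly (A d)) y) ∂(Measure.pi ν) := by
          rw [integral_const_mul,
            integral_finsetSum _ fun d _ => integrable_pi_of_continuous hν (hcd d),
            Finset.mul_sum]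
      _ ≤ _ := by
          refine Finset.sum_le_sum fun d hd => ?_
          obtain ⟨h1, h2⟩ := Finset.mem_Icc.1 hd
          rw [mul_assoc]
          exact mul_le_mul_of_nonneg_left (integral_schattenPow_homogPoly_le_sum hν ht h1
            (hsymm d h1 h2) W hW) (by positivity)
  refine ⟨?_, key.trans (Finset.sum_le_sum fun d hd => ?_), key.trans (le_of_eq ?_)⟩
  · have h := integrable_pi_of_continuous hν hcΦ
    rw [← hmap] at h
    exact h.comp_measurable hX
  · obtain ⟨h1, h2⟩ := Finset.mem_Icc.1 hd
    refine mul_le_mul_of_nonneg_left (Finset.sum_le_sum fun u _ => ?_) (by positivity)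
    exact rpow_mul_schattenPow_stepBlock_le_partialBlock hν (by linarith) h1 (hsymm d h1 h2) _ _
  · refine Finset.sum_congr rfl fun d hd => ?_
    obtain ⟨h1, h2⟩ := Finset.mem_Icc.1 hd
    congr 1
    refine Finset.sum_congr rfl fun u hu => ?_
    have hlen : (W u.1 u.2.1 u.2.2).length = d := by
      rw [← count_vert_add_count_horiz_add_count_diag, (hW _ _ _).1, (hW _ _ _).2.1,
        (hW _ _ _).2.2]
      exact (Finset.mem_filter.1 hu).2
    rw [decoupledBlock_eq (hsymm d h1 h2) hlen]
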